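/- Let $q,d\in\mathbb N$ and let $\|\cdot\|$ denote norms on $\mathbb R^d$ and on $\mathbb R^q$ under which every canonical unit vector has norm $1$. Consider a random bipartite graph between agents $1,\dots,q$ and objects $1,\dots,d$ in which the links $i\sim j$ are independent with probabilities $p_{ij}\in[0,1]$, where $p_{ij}>0$ for at least one pair $(i,j)$. Let $\deg(j)$ be the number of agents linked to object $j$, and let $A\in\mathbb R^{q\times d}$ be the random matrix $A_{ij}=\mathbf 1(i\sim j)/\deg(j)$, where $0/0:=0$. Let $V=(V_1,\dots,V_d)^\top$ be a random vector with nonnegative components, independent of the graph, with $\mathbb P(V_j>t)\sim K_jt^{-\alpha}$ as $t\to\infty$ for constants $\alpha>0$ and $K_1,\dots,K_d>0$. Suppose that $V$ is multivariate regularly varying with intensity measure $\mu$: $\mu\neq0$ is a Radon measure on $[0,\infty]^d\setminus\{0\}$ with no mass on points having an infinite coordinate, and $\mathbb P(V\in t\,\cdot)/\mathbb P(\|V\|>t)$ converges vaguely to $\mu$ as $t\to\infty$. Write $K^{1/\alpha}=\mathrm{diag}(K_1^{1/\alpha},\dots,K_d^{1/\alpha})$ and $1=(1,\dots,1)^\top\in\mathbb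 R^d$, and suppose that $V$ is asymptotically fully dependent, that is, $\mu$ is concentrated on the line $\{sK^{1/\alpha}1:\ s>0\}$. Let $F=AV$ and $\mathbb S^{q-1}_+=\{x\in[0,\infty)^q:\|x\|=1\}$. Then $F$ has a spectral measure $\overline\rho$ with tail index $\alpha$, that is, a probability measure $\overline\rho$ on $\mathbb S^{q-1}_+$ such that, for every $u>0$, $$\frac{\mathbb P(\|F\|>tu,\ F/\|F\|\in\cdot)}{\mathbb P(\|F\|>t)}\ \longrightarrow\ u^{-\alpha}\,\overline\rho(\cdot)\quad\text{vaguely as } t\to\infty .$$ Its support is $$\operatorname{supp}(\overline\rho)=\left\{\frac{MK^{1/\alpha}1}{\|MK^{1/\alpha}1\|}:\ M\in\operatorname{supp}(A),\ M1\neq0\right\},\qquad \operatorname{supp}(A)=\{M\in\mathbb R^{q\times d}:\ \mathbb P(A=M)>0\},$$ and, with $C^S_{dep}=\mathbb E\|AK^{1/\alpha}1\|^\alpha$, for every Borel set $B\subseteq\mathbb S^{q-1}_+$, $$\overline\rho(B)=\|K^{1/\alpha}1\|^{\alpha}\,(C^S_{dep})^{-1}\;\mathbb E\,\mu\circ A^{-1}\Big(\Big\{x\in[0,\infty]^q\setminus\{0\}:\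 \|x\|>1,\ \frac{x}{\|x\|}\in B\Big\}\Big),$$ where $\mu\circ A^{-1}(S)=\mu(\{x:Ax\in S\})$. -/

import Mathlib

open Filter Topology MeasureTheory ProbabilityTheory
open scoped ENNReal Matrix CompactlySupported

/-- A norm on `ℝⁿ` (a point-separating seminorm) under which all canonical unit vectors have
norm one. -/
structure IsUnitNorm {n : ℕ} (N : Seminorm ℝ (Fin n → ℝ)) : Prop where
  eq_zero : ∀ x, N x = 0 → x = 0
  unit : ∀ i, N (Pi.single i 1) = 1

/-- The space `[0,∞]ⁿ \ {0}` with the subspace topology. Its compact sets are exactly the compact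
subsets of `[0,∞]ⁿ` that do not contain the origin. -/
abbrev PuncturedOrthant (n : ℕ) : Type := ↥({0}ᶜ : Set (Fin n → ℝ≥0∞))

/-- The nonnegative part `{x ∈ ℝ₊ⁿ : ‖x‖ = 1}` of the unit sphere of the norm `N`. -/
abbrev PositiveSphere {n : ℕ} (N : Seminorm ℝ (Fin n → ℝ)) : Type :=
  ↥{x : Fin n → ℝ | (∀ i, 0 ≤ x i) ∧ N x = 1}

/-- Vague convergence of measures: convergence of the integrals of all continuous functions with
compact support. -/
def VagueTendsto {Y ι : Type*} [TopologicalSpace Y] [MeasurableSpace Y]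
    (m : ι → Measure Y) (l : Filter ι) (m' : Measure Y) : Prop :=
  ∀ f : C_c(Y, ℝ), Tendsto (fun i => ∫ y, f y ∂(m i)) l (𝓝 (∫ y, f y ∂m'))

/-- The extension of a norm to `[0,∞]ⁿ`, with value `∞` at the points with an infinite
coordinate. -/
noncomputable def extendedNorm {n : ℕ} (N : Seminorm ℝ (Fin n → ℝ)) (x : Fin n → ℝ≥0∞) : ℝ≥0∞ :=
  open Classical in
  if ∃ i, x i = ∞ then ∞ else ENNReal.ofReal (N fun i => (x i).toReal)

/-- The set `{‖x‖ > 1}` in `[0,∞]ⁿ \ {0}`. -/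
def outsideUnitBall {n : ℕ} (N : Seminorm ℝ (Fin n → ℝ)) : Set (PuncturedOrthant n) :=
  {x | 1 < extendedNorm N x.1}

/-- The dilated set `t D`. -/
def dilate {n : ℕ} (t : ℝ) (D : Set (PuncturedOrthant n)) : Set (PuncturedOrthant n) :=
  {x | ∃ y ∈ D, ∀ i, x.1 i = ENNReal.ofReal t * y.1 i}

/-- The measure `S ↦ P(X ∈ t S)` on `[0,∞]ⁿ \ {0}`, for a nonnegative random vector `X`
and `t > 0`. -/
noncomputable def scaledLaw {Ω : Type*} [MeasurableSpace Ω] (P : Measure Ω) {n : ℕ}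
    (X : Ω → Fin n → ℝ) (t : ℝ) : Measure (PuncturedOrthant n) :=
  (P.map fun ω i => ENNReal.ofReal (X ω i / t)).comap Subtype.val

/-- `μ` is the intensity measure of the nonnegative random vector `X`, normalized by the set `D`:
`μ` is a nonzero Radon measure on `[0,∞]ⁿ \ {0}` without mass at infinity, `D` is a relatively
compact Borel set with `μ(∂(tD)) = 0` for a dense set of `t > 0`, and
`P(X ∈ t ·) / P(X ∈ t D)` converges vaguely to `μ` as `t → ∞`. (On this locally compact second
countable space the Radon measures are the locally finite Borel measures.) -/
structure IsIntensityMeasure {Ω : Type*} [MeasurableSpace Ω] (P : Measure Ω) {n : ℕ}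
    (X : Ω → Fin n → ℝ) (D : Set (PuncturedOrthant n)) (μ : Measure (PuncturedOrthant n)) :
    Prop where
  measurable : Measurable X
  nonneg : ∀ᵐ ω ∂P, ∀ i, 0 ≤ X ω i
  radon : IsLocallyFiniteMeasure μ
  ne_zero : μ ≠ 0
  no_mass_at_infinity : μ {x | ∃ i, x.1 i = ∞} = 0
  measurableSet : MeasurableSet D
  relatively_compact : IsCompact (closure D)
  continuity_set : ∃ T : Set ℝ, T ⊆ Set.Ioi 0 ∧ Set.Ioi 0 ⊆ closure T ∧
    ∀ t ∈ T, μ (frontier (dilate t D)) = 0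
  vague : VagueTendsto (fun t : ℝ => (scaledLaw P X t D)⁻¹ • scaledLaw P X t) atTop μ

/-- The measure `B ↦ P(‖X‖ > s, X/‖X‖ ∈ B)` on the positive part of the unit sphere, for a
nonnegative random vector `X` and `s > 0`. -/
noncomputable def angularLaw {Ω : Type*} [MeasurableSpace Ω] (P : Measure Ω) {n : ℕ}
    (N : Seminorm ℝ (Fin n → ℝ)) (X : Ω → Fin n → ℝ) (s : ℝ) : Measure (PositiveSphere N) :=
  ((P.restrict {ω | s < N (X ω)}).map fun ω => (N (X ω))⁻¹ • X ω).comap Subtype.val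

/-- `ρ` is the spectral measure of the nonnegative random vector `X` with tail index `α`:
`ρ` is a probability measure on the positive part of the unit sphere, and for every `u > 0`,
`P(‖X‖ > t u, X/‖X‖ ∈ ·) / P(‖X‖ > t)` converges vaguely to `u^(-α) ρ` as `t → ∞`. -/
structure IsSpectralMeasure {Ω : Type*} [MeasurableSpace Ω] (P : Measure Ω) {n : ℕ}
    (N : Seminorm ℝ (Fin n → ℝ)) (X : Ω → Fin n → ℝ) (α : ℝ) (ρ : Measure (PositiveSphere N)) :
    Prop where
  measurable : Measurable X
  nonneg : ∀ᵐ ω ∂P, ∀ i, 0 ≤ X ω i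
  index_pos : 0 < α
  probability : IsProbabilityMeasure ρ
  vague : ∀ u : ℝ, 0 < u →
    VagueTendsto (fun t : ℝ => (P {ω | t < N (X ω)})⁻¹ • angularLaw P N X (t * u)) atTop
      (ENNReal.ofReal (u ^ (-α)) • ρ)

/-- The diagonal matrix `K^{1/α} = diag(K₁^{1/α}, …, K_d^{1/α})`. -/
noncomputable def tailScale {d : ℕ} (α : ℝ) (K : Fin d → ℝ) : Matrix (Fin d) (Fin d) ℝ :=
  Matrix.diagonal fun j => K j ^ (1 / α)

/-- The vector with limit measure `μ` is asymptotically fully dependent: `μ` is concentrated on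
the line `{s K^{1/α} 1 : s > 0}`. -/
def IsFullyDependent {d : ℕ} (α : ℝ) (K : Fin d → ℝ) (μ : Measure (PuncturedOrthant d)) : Prop :=
  μ {x | ∃ s : ℝ, 0 < s ∧ ∀ j, x.1 j = ENNReal.ofReal (s * (tailScale α K *ᵥ 1) j)}ᶜ = 0

/-- A random bipartite graph between `q` agents and `d` objects: `G ω i j` says whether agent `i`
is linked to object `j`; all links are independent and `i ∼ j` has probability `p i j`. -/
structure IsRandomBipartiteGraph {Ω : Type*} [MeasurableSpace Ω] (P : Measure Ω) {q d : ℕ}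
    (G : Ω → Fin q → Fin d → Bool) (p : Fin q → Fin d → ℝ) : Prop where
  measurable : Measurable G
  indep : iIndepFun (fun (e : Fin q × Fin d) ω => G ω e.1 e.2) P
  prob : ∀ i j, P.real {ω | G ω i j = true} = p i j

/-- The degree of an object: the number of agents linked to it. -/
def objectDegree {q d : ℕ} (g : Fin q → Fin d → Bool) (j : Fin d) : ℕ :=
  (Finset.univ.filter fun i => g i j = true).card

/-- The weighted adjacency matrix `A_ij = 1(i ∼ j) / deg(j)`, where `0 / 0 = 0`. -/
noncomputable def weightMatrix {q d : ℕ} (g : Fin q → Fin d → Bool) : Matrix (Fin q) (Fin d) ℝ :=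
  Matrix.of fun i j => (if g i j = true then 1 else 0) / (objectDegree g j : ℝ)

/-- The support `{M : P(A = M) > 0}` of a (discrete) random matrix. -/
def matrixSupport {Ω : Type*} [MeasurableSpace Ω] (P : Measure Ω) {q d : ℕ}
    (A : Ω → Matrix (Fin q) (Fin d) ℝ) : Set (Matrix (Fin q) (Fin d) ℝ) :=
  {M | 0 < P {ω | A ω = M}}

/-- `E μ∘A⁻¹ (S) = E μ({x : A x ∈ S})` for a random matrix `A` with nonnegative entries, acting on
`[0,∞]^d` with the convention `0 · ∞ = 0`. -/
noncomputable def expectedPushforward {Ω : Type*} [MeasurableSpace Ω] (P : Measure Ω) {q d : ℕ}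
    (A : Ω → Matrix (Fin q) (Fin d) ℝ) (μ : Measure (PuncturedOrthant d))
    (S : Set (PuncturedOrthant q)) : ℝ≥0∞ :=
  ∫⁻ ω, μ {x | ∃ y ∈ S, (A ω).map ENNReal.ofReal *ᵥ x.1 = y.1} ∂P

/-- The set `{‖x‖ > 1, x/‖x‖ ∈ B}` (its points have finite coordinates, since otherwise `x/‖x‖` is
not defined). -/
def coneOver {n : ℕ} (N : Seminorm ℝ (Fin n → ℝ)) (B : Set (PositiveSphere N)) :
    Set (PuncturedOrthant n) :=
  {x | (∀ i, x.1 i ≠ ∞) ∧ 1 < N (fun i => (x.1 i).toReal) ∧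
    ∃ b ∈ B, (N fun i => (x.1 i).toReal)⁻¹ • (fun i => (x.1 i).toReal) = b.1}

/-- The constant `C^S_dep = E ‖A K^{1/α} 1‖^α`. -/
noncomputable def systemicConstant {Ω : Type*} [MeasurableSpace Ω] (P : Measure Ω) {q d : ℕ}
    (N : Seminorm ℝ (Fin q → ℝ)) (A : Ω → Matrix (Fin q) (Fin d) ℝ) (α : ℝ) (K : Fin d → ℝ) : ℝ :=
  ∫ ω, N (A ω *ᵥ (tailScale α K *ᵥ 1)) ^ α ∂P

/-!
Full dependence makes `V` a one-factor vector. Write `k = K^{1/α} 1` and `R = V_o / k_o` for a fixed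
component `o`. Testing the vague convergence with functions that vanish on the line through `k`
shows that the differences `V_j / k_j - R` have tails of order `o(t^(-α))`
(`IsIntensityMeasure.hasPowerTail_sub`), whereas `P(R > t) ~ t^(-α)` by the Pareto tails. Hence
`M V = R (M k) + (negligible term)` for every fixed matrix `M`
(`IsIntensityMeasure.hasPowerTail_mulVec_sub`), so that `P(‖M V‖ > t) ~ ‖M k‖^α t^(-α)` and, given
`‖M V‖ > t`, the direction of `M V` concentrates at `M k / ‖M k‖`
(`HasPowerTail.tendsto_setIntegral`).

The random matrix `A` takes finitely many values and is independent of `V`, so conditioning on the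
graph (`ProbabilityTheory.IndepFun.integral_eq_sum`) yields an explicit spectral measure of `A V`:
the mixture of the point masses at `M k / ‖M k‖` with weights proportional to `P(A = M) ‖M k‖^α`
(`IsIntensityMeasure.isSpectralMeasure_mixture`). The positive sphere is compact, so it is the only
one (`IsSpectralMeasure.unique`), and its support can be read off.

The formula through `μ` holds because `μ` is determined by its values on rays,
`μ {s k : s > r} = r^(-α) / ‖k‖^α` (`IsIntensityMeasure.apply_ray`), which comes from the vague
convergence by squeezing with ramp functions and from `P(‖V‖ > t) ~ ‖k‖^α t^(-α)`. The preimage of a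
cone under `M` meets the line through `k` in such a ray or not at all
(`IsIntensityMeasure.apply_preimage_coneOver`).
-/

/-! ### Unit norms on `ℝⁿ` -/

namespace IsUnitNorm

variable {n : ℕ} {N : Seminorm ℝ (Fin n → ℝ)}

theorem le_sum_abs (hN : IsUnitNorm N) (x : Fin n → ℝ) : N x ≤ ∑ i, |x i| := by
  calc N x = N (∑ i, x i • Pi.single i (1 : ℝ)) := by
        congr 1
        rw [← Finset.univ_sum_single x]
        simp [← Pi.single_smul]
    _ ≤ ∑ i, N (x i • Pi.single i (1 : ℝ)) :=
        Finset.le_sum_of_subadditive N (map_zero N).le (map_add_le_add N) _ _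
    _ = ∑ i, |x i| := by simp [map_smul_eq_mul, hN.unit]

protected theorem continuous (hN : IsUnitNorm N) : Continuous N := by
  rw [continuous_iff_continuousAt]
  intro x
  have h : Tendsto (fun y : Fin n → ℝ => ∑ i, |y i - x i|) (𝓝 x) (𝓝 0) := by
    have : Continuous fun y : Fin n → ℝ => ∑ i, |y i - x i| := by fun_prop
    simpa using this.tendsto x
  refine tendsto_iff_dist_tendsto_zero.2 (squeeze_zero (fun _ => dist_nonneg) (fun y => ?_) h)
  rw [Real.dist_eq]
  exact (abs_sub_map_le_sub N y x).trans (hN.le_sum_abs (y - x))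

theorem pos (hN : IsUnitNorm N) {x : Fin n → ℝ} (hx : x ≠ 0) : 0 < N x :=
  lt_of_le_of_ne (apply_nonneg N x) fun h => hx (hN.eq_zero x h.symm)

/-- A unit norm dominates a multiple of the sup norm, by compactness of the sup-norm sphere. -/
theorem exists_mul_norm_le (hN : IsUnitNorm N) : ∃ c : ℝ, 0 < c ∧ ∀ x, c * ‖x‖ ≤ N x := by
  rcases (Metric.sphere (0 : Fin n → ℝ) 1).eq_empty_or_nonempty with h | h
  · refine ⟨1, one_pos, fun x => ?_⟩
    by_cases hx : x = 0
    · simp [hx]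
    · exact absurd (show ‖x‖⁻¹ • x ∈ Metric.sphere (0 : Fin n → ℝ) 1 by
        simp [norm_smul, norm_ne_zero_iff.2 hx]) (by simp [h])
  · obtain ⟨z, hz, hmin⟩ := (isCompact_sphere (0 : Fin n → ℝ) 1).exists_isMinOn h
      hN.continuous.continuousOn
    have hz0 : z ≠ 0 := by
      rintro rfl
      simp at hz
    refine ⟨N z, hN.pos hz0, fun x => ?_⟩
    by_cases hx : x = 0
    · simp [hx]
    have hx' : 0 < ‖x‖ := norm_pos_iff.2 hx
    have h1 : N z ≤ N (‖x‖⁻¹ • x) := hmin (show ‖x‖⁻¹ • x ∈ Metric.sphere (0 : Fin n → ℝ) 1 by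
      simp [norm_smul, hx'.ne'])
    rw [map_smul_eq_mul, norm_inv, norm_norm, inv_mul_eq_div, le_div_iff₀ hx'] at h1
    exact h1

theorem isCompact_positiveSphere (hN : IsUnitNorm N) :
    IsCompact {x : Fin n → ℝ | (∀ i, 0 ≤ x i) ∧ N x = 1} := by
  obtain ⟨c, hc, hle⟩ := hN.exists_mul_norm_le
  have hclosed : IsClosed {x : Fin n → ℝ | (∀ i, 0 ≤ x i) ∧ N x = 1} := by
    refine IsClosed.inter (s₁ := {x : Fin n → ℝ | ∀ i, 0 ≤ x i}) ?_
      (isClosed_eq hN.continuous continuous_const)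
    simp only [Set.ofPred_forall]
    exact isClosed_iInter fun i => isClosed_le continuous_const (continuous_apply i)
  refine (isCompact_closedBall (0 : Fin n → ℝ) c⁻¹).of_isClosed_subset hclosed fun x hx => ?_
  have := hle x
  rw [hx.2] at this
  rw [mem_closedBall_zero_iff, ← one_div, le_div_iff₀ hc, mul_comm]
  exact this

theorem compactSpace_positiveSphere (hN : IsUnitNorm N) : CompactSpace (PositiveSphere N) :=
  isCompact_iff_compactSpace.1 hN.isCompact_positiveSphere

end IsUnitNorm

/-! ### Power-law tails -/

/-- `X` has a power-law tail of index `α` with constant `c`: `t^α P(X > t) → c`. The constant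
`c = 0` is allowed and says that the tail of `X` is negligible compared with `t^(-α)`. -/
def HasPowerTail {Ω : Type*} [MeasurableSpace Ω] (P : Measure Ω) (α : ℝ) (X : Ω → ℝ) (c : ℝ) :
    Prop :=
  Tendsto (fun t : ℝ => t ^ α * P.real {ω | t < X ω}) atTop (𝓝 c)

/-- A function squeezed, for every small `ε > 0`, between functions whose limits tend to `c` as
`ε → 0` converges to `c`. -/
theorem tendsto_of_forall_squeeze {f : ℝ → ℝ} {l u : ℝ → ℝ → ℝ} {L U : ℝ → ℝ} {c : ℝ}
    (hl : ∀ᶠ ε in 𝓝[>] (0 : ℝ), Tendsto (l ε) atTop (𝓝 (L ε)))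
    (hu : ∀ᶠ ε in 𝓝[>] (0 : ℝ), Tendsto (u ε) atTop (𝓝 (U ε)))
    (hlf : ∀ᶠ ε in 𝓝[>] (0 : ℝ), ∀ᶠ t in atTop, l ε t ≤ f t)
    (hfu : ∀ᶠ ε in 𝓝[>] (0 : ℝ), ∀ᶠ t in atTop, f t ≤ u ε t)
    (hL : Tendsto L (𝓝[>] 0) (𝓝 c)) (hU : Tendsto U (𝓝[>] 0) (𝓝 c)) :
    Tendsto f atTop (𝓝 c) := by
  refine tendsto_order.2 ⟨fun a ha => ?_, fun b hb => ?_⟩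
  · obtain ⟨ε, h1, h2, h3⟩ := (hl.and (hlf.and ((tendsto_order.1 hL).1 a ha))).exists
    filter_upwards [(tendsto_order.1 h1).1 a h3, h2] with t ht1 ht2 using ht1.trans_le ht2
  · obtain ⟨ε, h1, h2, h3⟩ := (hu.and (hfu.and ((tendsto_order.1 hU).2 b hb))).exists
    filter_upwards [(tendsto_order.1 h1).2 b h3, h2] with t ht1 ht2 using ht2.trans_lt ht1

namespace HasPowerTail

variable {Ω : Type*} [MeasurableSpace Ω] {P : Measure Ω} {α : ℝ}
  {X Y Z : Ω → ℝ} {c : ℝ}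

theorem tendsto_mul_left (h : HasPowerTail P α X c) {a : ℝ} (ha : 0 < a) :
    Tendsto (fun t : ℝ => t ^ α * P.real {ω | a * t < X ω}) atTop (𝓝 (a ^ (-α) * c)) := by
  have h1 := (h.comp (tendsto_id.const_mul_atTop ha)).const_mul (a ^ (-α))
  refine h1.congr' ?_
  filter_upwards [eventually_gt_atTop 0] with t ht
  simp only [Function.comp, id]
  rw [Real.mul_rpow ha.le ht.le, ← mul_assoc, ← mul_assoc, ← Real.rpow_add ha]
  simp

theorem const_mul (h : HasPowerTail P α X c) {a : ℝ} (ha : 0 < a) :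
    HasPowerTail P α (fun ω => a * X ω) (a ^ α * c) := by
  have h1 := h.tendsto_mul_left (inv_pos.2 ha)
  rw [Real.inv_rpow ha.le, Real.rpow_neg ha.le, inv_inv] at h1
  refine h1.congr fun t => ?_
  congr 2
  ext ω
  exact inv_mul_lt_iff₀ ha

theorem div_const_one {a : ℝ} (ha : 0 < a) (hX : HasPowerTail P α X (a ^ α)) :
    HasPowerTail P α (fun ω => X ω / a) 1 := by
  have h := hX.const_mul (inv_pos.2 ha)
  rw [Real.inv_rpow ha.le, inv_mul_cancel₀ (Real.rpow_pos_of_pos ha _).ne'] at h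
  simpa only [div_eq_inv_mul] using h

theorem zero : HasPowerTail P α (fun _ => 0) 0 := by
  refine tendsto_const_nhds.congr' ?_
  filter_upwards [eventually_gt_atTop 0] with t ht
  simp [ht.not_gt]

variable [IsProbabilityMeasure P]

/-- A perturbation with negligible tail does not change the tail. -/
theorem of_abs_sub_le (hX : HasPowerTail P α X c) (hZ : HasPowerTail P α Z 0)
    (hYX : ∀ᵐ ω ∂P, |Y ω - X ω| ≤ Z ω) : HasPowerTail P α Y c := by
  have hpos : ∀ᶠ ε in 𝓝[>] (0 : ℝ), 0 < ε := eventually_mem_nhdsWithin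
  have hlt : ∀ᶠ ε in 𝓝[>] (0 : ℝ), ε < 1 :=
    eventually_nhdsWithin_of_eventually_nhds (gt_mem_nhds one_pos)
  refine tendsto_of_forall_squeeze
    (l := fun ε t => t ^ α * P.real {ω | (1 + ε) * t < X ω} - t ^ α * P.real {ω | ε * t < Z ω})
    (u := fun ε t => t ^ α * P.real {ω | (1 - ε) * t < X ω} + t ^ α * P.real {ω | ε * t < Z ω})
    (L := fun ε => (1 + ε) ^ (-α) * c) (U := fun ε => (1 - ε) ^ (-α) * c) ?_ ?_ ?_ ?_ ?_ ?_
  · filter_upwards [hpos] with ε hε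
    simpa using (hX.tendsto_mul_left (by linarith : 0 < 1 + ε)).sub (hZ.tendsto_mul_left hε)
  · filter_upwards [hpos, hlt] with ε hε hε1
    simpa using (hX.tendsto_mul_left (by linarith : 0 < 1 - ε)).add (hZ.tendsto_mul_left hε)
  · filter_upwards with ε
    filter_upwards [eventually_gt_atTop 0] with t ht
    rw [← mul_sub]
    refine mul_le_mul_of_nonneg_left ?_ (Real.rpow_nonneg ht.le _)
    rw [sub_le_iff_le_add]
    refine (ENNReal.toReal_mono (measure_ne_top P ({ω | t < Y ω} ∪ {ω | ε * t < Z ω}))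
      (measure_mono_ae ?_)).trans (measureReal_union_le _ _)
    filter_upwards [hYX] with ω hω (h : (1 + ε) * t < X ω)
    by_contra hcon
    obtain ⟨h1, h2⟩ := not_or.1 hcon
    have h1 : Y ω ≤ t := not_lt.1 h1
    have h2 : Z ω ≤ ε * t := not_lt.1 h2
    linarith [(abs_le.1 hω).1]
  · filter_upwards with ε
    filter_upwards [eventually_gt_atTop 0] with t ht
    rw [← mul_add]
    refine mul_le_mul_of_nonneg_left ?_ (Real.rpow_nonneg ht.le _)
    refine (ENNReal.toReal_mono
      (measure_ne_top P ({ω | (1 - ε) * t < X ω} ∪ {ω | ε * t < Z ω}))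
      (measure_mono_ae ?_)).trans (measureReal_union_le _ _)
    filter_upwards [hYX] with ω hω (h : t < Y ω)
    by_contra hcon
    obtain ⟨h1, h2⟩ := not_or.1 hcon
    have h1 : X ω ≤ (1 - ε) * t := not_lt.1 h1
    have h2 : Z ω ≤ ε * t := not_lt.1 h2
    linarith [(abs_le.1 hω).2]
  · have : ContinuousAt (fun ε : ℝ => (1 + ε) ^ (-α) * c) 0 :=
      ((continuousAt_const.add continuousAt_id).rpow_const (Or.inl (by simp))).mul
        continuousAt_const
    simpa using this.tendsto.mono_left nhdsWithin_le_nhds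
  · have : ContinuousAt (fun ε : ℝ => (1 - ε) ^ (-α) * c) 0 :=
      ((continuousAt_const.sub continuousAt_id).rpow_const (Or.inl (by simp))).mul
        continuousAt_const
    simpa using this.tendsto.mono_left nhdsWithin_le_nhds

theorem zero_mono (hZ : HasPowerTail P α Z 0) (h : ∀ᵐ ω ∂P, |X ω| ≤ Z ω) :
    HasPowerTail P α X 0 :=
  zero.of_abs_sub_le hZ (by simpa using h)

theorem zero_sum {ι : Type*} (s : Finset ι) {X : ι → Ω → ℝ} (h0 : ∀ i ω, 0 ≤ X i ω)
    (h : ∀ i, HasPowerTail P α (X i) 0) : HasPowerTail P α (fun ω => ∑ i ∈ s, X i ω) 0 := by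
  classical
  induction s using Finset.induction_on with
  | empty => simpa using zero
  | insert i s hi ih =>
    refine ih.of_abs_sub_le (h i) (ae_of_all _ fun ω => ?_)
    rw [Finset.sum_insert hi, add_sub_cancel_right, abs_of_nonneg (h0 i ω)]

end HasPowerTail

/-- A vector whose components have negligible tails has a norm with negligible tail. -/
theorem HasPowerTail.zero_seminorm {Ω : Type*} [MeasurableSpace Ω] {P : Measure Ω}
    [IsProbabilityMeasure P] {α : ℝ} {n : ℕ} {N : Seminorm ℝ (Fin n → ℝ)} (hN : IsUnitNorm N)
    {Z : Ω → Fin n → ℝ} (h : ∀ i, HasPowerTail P α (fun ω => |Z ω i|) 0) :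
    HasPowerTail P α (fun ω => N (Z ω)) 0 :=
  (HasPowerTail.zero_sum Finset.univ (fun _ _ => abs_nonneg _) h).zero_mono
    (ae_of_all _ fun ω => by
      rw [abs_of_nonneg (apply_nonneg N _)]
      exact hN.le_sum_abs _)

/-! ### Directions of a vector close to a ray -/

/-- If `x = r w + z`, then the direction of `x` differs from that of `w` by at most
`2 ‖z‖ / ‖x‖`. -/
theorem Seminorm.direction_sub_le {E : Type*} [AddCommGroup E] [Module ℝ E] (N : Seminorm ℝ E)
    {w x : E} {r : ℝ} (hr : 0 ≤ r) (hw : 0 < N w) (hx : 0 < N x) :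
    N ((N x)⁻¹ • x - (N w)⁻¹ • w) ≤ 2 * N (x - r • w) / N x := by
  have h1 : (N x)⁻¹ • x - (N w)⁻¹ • w
      = (N x)⁻¹ • ((x - r • w) + (r - N x * (N w)⁻¹) • w) := by
    rw [sub_smul, add_sub, sub_add_cancel, smul_sub, smul_smul, ← mul_assoc,
      inv_mul_cancel₀ hx.ne', one_mul]
  have h2 : N ((r - N x * (N w)⁻¹) • w) ≤ N (x - r • w) := by
    have h3 : |N (r • w) - N x| ≤ N (x - r • w) := by
      rw [abs_sub_comm]
      exact abs_sub_map_le_sub N x (r • w)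
    rw [map_smul_eq_mul, Real.norm_of_nonneg hr] at h3
    have h4 : (r - N x * (N w)⁻¹) * N w = r * N w - N x := by
      rw [sub_mul, inv_mul_cancel_right₀ hw.ne']
    calc N ((r - N x * (N w)⁻¹) • w) = |r - N x * (N w)⁻¹| * |N w| := by
          rw [map_smul_eq_mul, Real.norm_eq_abs, abs_of_pos hw]
      _ ≤ N (x - r • w) := by rwa [← abs_mul, h4]
  rw [h1, map_smul_eq_mul, norm_inv, Real.norm_of_nonneg hx.le, inv_mul_eq_div]
  gcongr
  linarith [map_add_le_add N (x - r • w) ((r - N x * (N w)⁻¹) • w)]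

/-- If `W = R w + Z` with `R` of power-law tail and `Z` negligible, then the large values of `W`
point in the direction of `w`: averages of a function `φ` of `W` over `{‖W‖ > t}` only see the
value `c` that `φ` approaches in that direction. -/
theorem HasPowerTail.tendsto_setIntegral {Ω : Type*} [MeasurableSpace Ω] {P : Measure Ω}
    [IsProbabilityMeasure P] {α : ℝ} {n : ℕ} {N : Seminorm ℝ (Fin n → ℝ)}
    (hN : IsUnitNorm N) {W : Ω → Fin n → ℝ} (hW : Measurable W) (hW0 : ∀ᵐ ω ∂P, ∀ i, 0 ≤ W ω i)
    {R : Ω → ℝ} (hR0 : ∀ᵐ ω ∂P, 0 ≤ R ω) {w : Fin n → ℝ} (hw : 0 < N w)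
    (hR : HasPowerTail P α R 1) (hZ : HasPowerTail P α (fun ω => N (W ω - R ω • w)) 0)
    {φ : (Fin n → ℝ) → ℝ} (hφ : Measurable φ) {C c : ℝ} (hC : ∀ x, |φ x| ≤ C)
    (hc : ∀ δ > 0, ∃ η > 0, ∀ x : Fin n → ℝ, (∀ i, 0 ≤ x i) → 0 < N x →
      N ((N x)⁻¹ • x - (N w)⁻¹ • w) ≤ η → |φ x - c| ≤ δ) :
    Tendsto (fun t : ℝ => t ^ α * ∫ ω in {ω | t < N (W ω)}, φ (W ω) ∂P) atTop
      (𝓝 (N w ^ α * c)) := by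
  have hNW : Measurable fun ω => N (W ω) := hN.continuous.measurable.comp hW
  have hNWtail : HasPowerTail P α (fun ω => N (W ω)) (N w ^ α) := by
    have h := (hR.const_mul hw).of_abs_sub_le (Y := fun ω => N (W ω)) hZ (by
      filter_upwards [hR0] with ω hω
      have := abs_sub_map_le_sub N (W ω) (R ω • w)
      rwa [map_smul_eq_mul, Real.norm_of_nonneg hω, mul_comm] at this)
    simpa using h
  have hC0 : 0 ≤ C := (abs_nonneg _).trans (hC 0)
  have hpos : ∀ᶠ δ in 𝓝[>] (0 : ℝ), 0 < δ := eventually_mem_nhdsWithin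
  choose! η hη hηφ using hc
  have key : ∀ δ > 0, ∀ t > 0,
      |(∫ ω in {ω | t < N (W ω)}, φ (W ω) ∂P) - c * P.real {ω | t < N (W ω)}|
        ≤ δ * P.real {ω | t < N (W ω)}
          + (C + |c|) * P.real {ω | η δ / 2 * t < N (W ω - R ω • w)} := by
    intro δ hδ t ht
    set S := {ω | t < N (W ω)} with hS
    have hSm : MeasurableSet S := measurableSet_lt measurable_const hNW
    -- `R` need not be measurable, so the exceptional set is replaced by a measurable hull.
    set B := toMeasurable P {ω | η δ / 2 * t < N (W ω - R ω • w)} with hB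
    have hBm : MeasurableSet B := measurableSet_toMeasurable _ _
    have hBP : P.real B = P.real {ω | η δ / 2 * t < N (W ω - R ω • w)} := by
      simp only [Measure.real, hB, measure_toMeasurable]
    have hint : Integrable (fun ω => φ (W ω)) P :=
      Integrable.of_bound (hφ.comp hW).aestronglyMeasurable C (ae_of_all _ fun ω => hC _)
    have h1 : (∫ ω in S, φ (W ω) ∂P) - c * P.real S = ∫ ω in S, (φ (W ω) - c) ∂P := by
      rw [integral_sub hint.integrableOn (integrable_const c)]
      simp [mul_comm]
    have h2 : ∫ ω, (S.indicator (fun _ => δ) ω + B.indicator (fun _ => C + |c|) ω) ∂P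
        = δ * P.real S + (C + |c|) * P.real B := by
      rw [integral_add ((integrable_const _).indicator hSm) ((integrable_const _).indicator hBm),
        integral_indicator_const _ hSm, integral_indicator_const _ hBm]
      simp [mul_comm]
    rw [h1, ← hBP, ← h2, ← integral_indicator hSm, ← Real.norm_eq_abs]
    refine norm_integral_le_of_norm_le
      (((integrable_const _).indicator hSm).add ((integrable_const _).indicator hBm)) ?_
    filter_upwards [hW0, hR0] with ω hω hRω
    have hBnn : 0 ≤ B.indicator (fun _ => C + |c|) ω :=
      Set.indicator_nonneg (fun _ _ => by positivity) _
    by_cases hωS : ω ∈ S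
    · rw [Set.indicator_of_mem hωS, Set.indicator_of_mem hωS, Real.norm_eq_abs]
      by_cases hωB : ω ∈ B
      · rw [Set.indicator_of_mem hωB]
        linarith [abs_sub (φ (W ω)) c, hC (W ω)]
      · have hωB' : N (W ω - R ω • w) ≤ η δ / 2 * t :=
          not_lt.1 fun h => hωB (subset_toMeasurable P _ h)
        have hωS' : t < N (W ω) := hωS
        have hpos : 0 < N (W ω) := ht.trans hωS'
        refine (hηφ δ hδ (W ω) hω hpos ?_).trans (by linarith)
        refine (N.direction_sub_le hRω hw hpos).trans ?_
        rw [div_le_iff₀ hpos]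
        nlinarith [hη δ hδ]
    · simpa [Set.indicator_of_notMem hωS] using hBnn
  have hlim : ∀ a : ℝ, ∀ δ > 0, Tendsto (fun t : ℝ => t ^ α * (a * P.real {ω | t < N (W ω)}
      + (C + |c|) * P.real {ω | η δ / 2 * t < N (W ω - R ω • w)})) atTop (𝓝 (N w ^ α * a)) := by
    intro a δ hδ
    have h := (hNWtail.mul_const a).add
      ((hZ.tendsto_mul_left (half_pos (hη δ hδ))).mul_const (C + |c|))
    simp only [mul_zero, zero_mul, add_zero] at h
    refine h.congr fun t => ?_
    ring
  have hlim' : ∀ a : ℝ, ∀ δ > 0, Tendsto (fun t : ℝ => t ^ α * (a * P.real {ω | t < N (W ω)}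
      - (C + |c|) * P.real {ω | η δ / 2 * t < N (W ω - R ω • w)})) atTop (𝓝 (N w ^ α * a)) := by
    intro a δ hδ
    have h := (hNWtail.mul_const a).sub
      ((hZ.tendsto_mul_left (half_pos (hη δ hδ))).mul_const (C + |c|))
    simp only [mul_zero, zero_mul, sub_zero] at h
    refine h.congr fun t => ?_
    ring
  refine tendsto_of_forall_squeeze (hpos.mono fun δ hδ => hlim' (c - δ) δ hδ)
    (hpos.mono fun δ hδ => hlim (c + δ) δ hδ) ?_ ?_ ?_ ?_
  · filter_upwards [hpos] with δ hδ
    filter_upwards [eventually_gt_atTop 0] with t ht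
    refine mul_le_mul_of_nonneg_left ?_ (Real.rpow_nonneg ht.le _)
    linarith [(abs_le.1 (key δ hδ t ht)).1]
  · filter_upwards [hpos] with δ hδ
    filter_upwards [eventually_gt_atTop 0] with t ht
    refine mul_le_mul_of_nonneg_left ?_ (Real.rpow_nonneg ht.le _)
    linarith [(abs_le.1 (key δ hδ t ht)).2]
  · have : Continuous fun δ : ℝ => N w ^ α * (c - δ) := by fun_prop
    simpa using (this.tendsto 0).mono_left nhdsWithin_le_nhds
  · have : Continuous fun δ : ℝ => N w ^ α * (c + δ) := by fun_prop
    simpa using (this.tendsto 0).mono_left nhdsWithin_le_nhds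

/-! ### Vague convergence to the intensity measure -/

theorem isCompact_punctured_preimage {n : ℕ} {C : Set (Fin n → ℝ≥0∞)} (hC : IsClosed C)
    (h0 : 0 ∉ C) : IsCompact (Subtype.val ⁻¹' C : Set (PuncturedOrthant n)) :=
  (Topology.IsInducing.subtypeVal.isCompact_preimage_iff fun x hx =>
    ⟨⟨x, fun h : x = 0 => h0 (h ▸ hx)⟩, rfl⟩).2 hC.isCompact

/-- The coordinate `x ∈ [0,∞]` in units of `k`, truncated at level `L`. The truncation makes it a
continuous real function up to `x = ∞`. -/
noncomputable def truncatedCoord (k L : ℝ) (x : ℝ≥0∞) : ℝ :=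
  (min x (ENNReal.ofReal (L * k))).toReal / k

theorem continuous_truncatedCoord (k L : ℝ) : Continuous (truncatedCoord k L) := by
  refine Continuous.div_const ?_ k
  refine ENNReal.continuousOn_toReal.comp_continuous (by fun_prop) fun x => ?_
  exact ((min_le_right _ _).trans_lt ENNReal.ofReal_lt_top).ne

theorem truncatedCoord_ofReal {k L s : ℝ} (hk : 0 < k) (hL : 0 ≤ L) (hs : 0 ≤ s) :
    truncatedCoord k L (ENNReal.ofReal s) = min (s / k) L := by
  have hmin : min (ENNReal.ofReal s) (ENNReal.ofReal (L * k)) = ENNReal.ofReal (min s (L * k)) :=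
    (ENNReal.ofReal_mono.map_min (a := s) (b := L * k)).symm
  rw [truncatedCoord, hmin, ENNReal.toReal_ofReal (le_min hs (by positivity)),
    ← min_div_div_right hk.le, mul_div_cancel_right₀ _ hk.ne']

theorem truncatedCoord_zero (k L : ℝ) : truncatedCoord k L 0 = 0 := by
  simp [truncatedCoord]

/-- A test function that vanishes near the origin and on the line spanned by `k`, and detects a
difference of the components `j` and `o` as long as both are at most `L` in units of `k`. -/
noncomputable def discrepancy {d : ℕ} (k : Fin d → ℝ) (o j : Fin d) (L : ℝ)
    (x : Fin d → ℝ≥0∞) : ℝ :=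
  max (|truncatedCoord (k j) L (x j) - truncatedCoord (k o) L (x o)| - 1 / 2) 0

section Discrepancy

variable {d : ℕ} (k : Fin d → ℝ) (o j : Fin d) (L : ℝ)

theorem discrepancy_nonneg (x : Fin d → ℝ≥0∞) : 0 ≤ discrepancy k o j L x := le_max_right _ _

theorem le_discrepancy (x : Fin d → ℝ≥0∞) :
    |truncatedCoord (k j) L (x j) - truncatedCoord (k o) L (x o)| - 1 / 2
      ≤ discrepancy k o j L x := le_max_left _ _

theorem continuous_discrepancy : Continuous (discrepancy k o j L) :=
  ((((continuous_truncatedCoord (k j) L).comp (continuous_apply j)).sub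
    ((continuous_truncatedCoord (k o) L).comp (continuous_apply o))).abs.sub
      continuous_const).max continuous_const

theorem eventually_discrepancy_eq_zero : ∀ᶠ x in 𝓝 0, discrepancy k o j L x = 0 := by
  have hc : Continuous fun x : Fin d → ℝ≥0∞ =>
      |truncatedCoord (k j) L (x j) - truncatedCoord (k o) L (x o)| :=
    (((continuous_truncatedCoord (k j) L).comp (continuous_apply j)).sub
      ((continuous_truncatedCoord (k o) L).comp (continuous_apply o))).abs
  have := hc.tendsto 0
  simp only [Pi.zero_apply, truncatedCoord_zero, sub_zero, abs_zero] at this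
  filter_upwards [(tendsto_order.1 this).2 (1 / 2) (by norm_num)] with x hx
  exact max_eq_right (by linarith)

end Discrepancy

section Intensity

variable {Ω : Type*} [MeasurableSpace Ω] {P : Measure Ω} {d : ℕ}
  {N : Seminorm ℝ (Fin d → ℝ)} {V : Ω → Fin d → ℝ} {μ : Measure (PuncturedOrthant d)}

theorem scaledLaw_outsideUnitBall (hμ : IsIntensityMeasure P V (outsideUnitBall N) μ) {t : ℝ}
    (ht : 0 < t) : scaledLaw P V t (outsideUnitBall N) = P {ω | t < N (V ω)} := by
  have hmeas : MeasurableSet (Subtype.val '' outsideUnitBall N : Set (Fin d → ℝ≥0∞)) :=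
    (MeasurableEmbedding.subtype_coe
      (measurableSet_singleton (0 : Fin d → ℝ≥0∞)).compl).measurableSet_image.2 hμ.measurableSet
  have hVm : Measurable fun ω i => ENNReal.ofReal (V ω i / t) :=
    measurable_pi_lambda _ fun i =>
      (((measurable_pi_apply i).comp hμ.measurable).div_const t).ennreal_ofReal
  rw [scaledLaw, (MeasurableEmbedding.subtype_coe
      (measurableSet_singleton (0 : Fin d → ℝ≥0∞)).compl).comap_apply,
    Measure.map_apply hVm hmeas]
  refine measure_congr ?_
  filter_upwards [hμ.nonneg] with ω hω
  have hnorm : extendedNorm N (fun i => ENNReal.ofReal (V ω i / t))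
      = ENNReal.ofReal (N (V ω) / t) := by
    rw [extendedNorm, if_neg (by simp)]
    congr 1
    have : (fun i => (ENNReal.ofReal (V ω i / t)).toReal) = t⁻¹ • V ω := by
      ext i
      rw [ENNReal.toReal_ofReal (div_nonneg (hω i) ht.le)]
      simp [div_eq_inv_mul]
    rw [this, map_smul_eq_mul, norm_inv, Real.norm_of_nonneg ht.le, inv_mul_eq_div]
  refine propext ⟨?_, fun h => ?_⟩
  · rintro ⟨y, hy, hyV⟩
    have hy : 1 < extendedNorm N y.1 := hy
    rw [hyV, hnorm, ENNReal.one_lt_ofReal, one_lt_div ht] at hy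
    exact hy
  · have h : t < N (V ω) := h
    have h1 : 1 < extendedNorm N (fun i => ENNReal.ofReal (V ω i / t)) := by
      rwa [hnorm, ENNReal.one_lt_ofReal, one_lt_div ht]
    refine ⟨⟨fun i => ENNReal.ofReal (V ω i / t), ?_⟩, h1, rfl⟩
    intro h0
    rw [Set.mem_singleton_iff.1 h0] at h1
    simp [extendedNorm, ← Pi.zero_def] at h1

/-- Vague convergence to the intensity measure, for test functions given on all of `[0,∞]^d` that
vanish near the origin. -/
theorem IsIntensityMeasure.tendsto_integral (hμ : IsIntensityMeasure P V (outsideUnitBall N) μ)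
    {h : (Fin d → ℝ≥0∞) → ℝ} (hcont : Continuous h) (h0 : ∀ᶠ x in 𝓝 0, h x = 0) :
    Tendsto (fun t : ℝ => (P.real {ω | t < N (V ω)})⁻¹ *
      ∫ ω, h (fun i => ENNReal.ofReal (V ω i / t)) ∂P) atTop (𝓝 (∫ x, h x.1 ∂μ)) := by
  obtain ⟨U, hU, hUo, hU0⟩ := eventually_nhds_iff.1 h0
  have hcpt : IsCompact (Subtype.val ⁻¹' Uᶜ : Set (PuncturedOrthant d)) :=
    isCompact_punctured_preimage hUo.isClosed_compl (not_not.2 hU0)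
  let f : C_c(PuncturedOrthant d, ℝ) :=
    ⟨⟨fun x => h x.1, hcont.comp continuous_subtype_val⟩,
      HasCompactSupport.intro hcpt fun x hx => hU _ (by simpa using hx)⟩
  refine (hμ.vague f).congr' ?_
  filter_upwards [eventually_gt_atTop 0] with t ht
  have hVm : Measurable fun ω i => ENNReal.ofReal (V ω i / t) :=
    measurable_pi_lambda _ fun i =>
      (((measurable_pi_apply i).comp hμ.measurable).div_const t).ennreal_ofReal
  change ∫ x, h x.1 ∂((scaledLaw P V t (outsideUnitBall N))⁻¹ • scaledLaw P V t) = _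
  rw [integral_smul_measure, scaledLaw_outsideUnitBall hμ ht, ENNReal.toReal_inv, smul_eq_mul]
  congr 1
  rw [scaledLaw, integral_subtype_comap (measurableSet_singleton (0 : Fin d → ℝ≥0∞)).compl h,
    setIntegral_eq_integral_of_forall_compl_eq_zero, integral_map hVm.aemeasurable
      hcont.measurable.aestronglyMeasurable]
  intro x hx
  have : x = 0 := by simpa using hx
  rw [this, hU 0 hU0]

variable [IsProbabilityMeasure P] {α : ℝ} {k : Fin d → ℝ}

/-- The normalizing probability `P(‖V‖ > t)` is positive and at most of order `t^(-α)`. -/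
theorem IsIntensityMeasure.eventually_norm_tail_le
    (hμ : IsIntensityMeasure P V (outsideUnitBall N) μ) (hN : IsUnitNorm N) (hk : ∀ j, 0 < k j)
    (hV : ∀ j, HasPowerTail P α (fun ω => V ω j) (k j ^ α)) (o : Fin d) :
    ∃ C : ℝ, ∀ᶠ t in atTop, 0 < P.real {ω | t < N (V ω)} ∧
      t ^ α * P.real {ω | t < N (V ω)} ≤ C := by
  obtain ⟨c, hc, hcN⟩ := hN.exists_mul_norm_le
  have hup : Tendsto (fun t : ℝ => ∑ j, t ^ α * P.real {ω | (d : ℝ)⁻¹ * t < V ω j}) atTop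
      (𝓝 (∑ j, ((d : ℝ)⁻¹) ^ (-α) * k j ^ α)) := by
    have hd : 0 < (d : ℝ)⁻¹ := inv_pos.2 (Nat.cast_pos.2 o.pos)
    exact tendsto_finsetSum _ fun j _ => (hV j).tendsto_mul_left hd
  have hlow := (hV o).tendsto_mul_left (inv_pos.2 hc)
  have hlim : 0 < (c⁻¹) ^ (-α) * k o ^ α :=
    mul_pos (Real.rpow_pos_of_pos (inv_pos.2 hc) _) (Real.rpow_pos_of_pos (hk o) _)
  refine ⟨(∑ j, ((d : ℝ)⁻¹) ^ (-α) * k j ^ α) + 1, ?_⟩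
  filter_upwards [(tendsto_order.1 hlow).1 0 hlim, (tendsto_order.1 hup).2 _ (lt_add_one _),
    eventually_gt_atTop 0] with t h1 h2 ht
  have htα : 0 < t ^ α := Real.rpow_pos_of_pos ht _
  constructor
  · refine (pos_of_mul_pos_right h1 htα.le).trans_le (measureReal_mono ?_)
    intro ω hω
    have hω : c⁻¹ * t < V ω o := hω
    rw [inv_mul_lt_iff₀ hc] at hω
    refine hω.trans_le (le_trans ?_ (hcN (V ω)))
    gcongr
    exact (le_abs_self _).trans (norm_le_pi_norm (V ω) o)
  · refine le_trans ?_ h2.le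
    rw [← Finset.mul_sum]
    refine mul_le_mul_of_nonneg_left ?_ htα.le
    refine le_trans ?_ (measureReal_iUnion_fintype_le _)
    refine ENNReal.toReal_mono (measure_ne_top _ _) (measure_mono_ae ?_)
    filter_upwards [hμ.nonneg] with ω hω (h : t < N (V ω))
    by_contra hcon
    have hcon : ∀ j, V ω j ≤ (d : ℝ)⁻¹ * t := fun j =>
      not_lt.1 fun hj => hcon (Set.mem_iUnion.2 ⟨j, hj⟩)
    have h1 : N (V ω) ≤ ∑ _j : Fin d, (d : ℝ)⁻¹ * t :=
      (hN.le_sum_abs _).trans (Finset.sum_le_sum fun j _ => by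
        rw [abs_of_nonneg (hω j)]
        exact hcon j)
    have hd : (d : ℝ) ≠ 0 := (Nat.cast_pos.2 o.pos).ne'
    rw [Finset.sum_const, Finset.card_univ, Fintype.card_fin, nsmul_eq_mul, ← mul_assoc,
      mul_inv_cancel₀ hd, one_mul] at h1
    linarith

/-- Full dependence: the components of `V`, measured in units of `k`, differ from each other by
amounts with negligible tail. -/
theorem IsIntensityMeasure.hasPowerTail_sub
    (hμ : IsIntensityMeasure P V (outsideUnitBall N) μ) (hN : IsUnitNorm N) (hk : ∀ j, 0 < k j)
    (hα : 0 < α)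
    (hV : ∀ j, HasPowerTail P α (fun ω => V ω j) (k j ^ α))
    (hline : μ {x | ∃ s : ℝ, 0 < s ∧ ∀ j, x.1 j = ENNReal.ofReal (s * k j)}ᶜ = 0)
    (o j : Fin d) : HasPowerTail P α (fun ω => |V ω j / k j - V ω o / k o|) 0 := by
  have hX : ∀ j, HasPowerTail P α (fun ω => V ω j / k j) 1 :=
    fun j => (hV j).div_const_one (hk j)
  obtain ⟨C, hC⟩ := hμ.eventually_norm_tail_le hN hk hV o
  have hint : ∀ L, 0 ≤ L → ∫ x, discrepancy k o j L x.1 ∂μ = 0 := by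
    intro L hL
    refine integral_eq_zero_of_ae ?_
    filter_upwards [compl_mem_ae_iff.2 hline] with x hx
    obtain ⟨s, hs, hx⟩ := not_not.1 hx
    have e : ∀ i, truncatedCoord (k i) L (x.1 i) = min s L := fun i => by
      rw [hx i, truncatedCoord_ofReal (hk i) hL (mul_pos hs (hk i)).le,
        mul_div_cancel_right₀ _ (hk i).ne']
    simp only [discrepancy, e, sub_self, abs_zero, Pi.zero_apply]
    norm_num
  have hlim : ∀ L, 0 ≤ L → Tendsto (fun t : ℝ =>
      t ^ α * ∫ ω, discrepancy k o j L (fun i => ENNReal.ofReal (V ω i / t)) ∂P) atTop (𝓝 0) := by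
    intro L hL
    have h1 := hμ.tendsto_integral (continuous_discrepancy k o j L)
      (eventually_discrepancy_eq_zero k o j L)
    rw [hint L hL] at h1
    have h2 := h1.const_mul C
    rw [mul_zero] at h2
    refine tendsto_of_tendsto_of_tendsto_of_le_of_le' tendsto_const_nhds h2 ?_ ?_
    · filter_upwards [eventually_gt_atTop 0] with t ht
      exact mul_nonneg (Real.rpow_nonneg ht.le _)
        (integral_nonneg fun ω => discrepancy_nonneg _ _ _ _ _)
    · filter_upwards [hC] with t ht
      have hI : 0 ≤ ∫ ω, discrepancy k o j L (fun i => ENNReal.ofReal (V ω i / t)) ∂P :=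
        integral_nonneg fun ω => discrepancy_nonneg _ _ _ _ _
      calc t ^ α * ∫ ω, discrepancy k o j L (fun i => ENNReal.ofReal (V ω i / t)) ∂P
          = (t ^ α * P.real {ω | t < N (V ω)}) * ((P.real {ω | t < N (V ω)})⁻¹ *
            ∫ ω, discrepancy k o j L (fun i => ENNReal.ofReal (V ω i / t)) ∂P) := by
              rw [mul_assoc, mul_inv_cancel_left₀ ht.1.ne']
        _ ≤ _ := mul_le_mul_of_nonneg_right ht.2 (mul_nonneg (inv_nonneg.2 ht.1.le) hI)
  have hpos : ∀ᶠ ε in 𝓝[>] (0 : ℝ), 0 < ε := eventually_mem_nhdsWithin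
  -- The truncation level is `L = 1 / ε`.
  refine tendsto_of_forall_squeeze (l := fun _ _ => 0) (L := fun _ => 0)
    (u := fun ε t => t ^ α * P.real {ω | ε⁻¹ * t < V ω j / k j}
      + t ^ α * P.real {ω | ε⁻¹ * t < V ω o / k o}
      + 2 * (t ^ α * ∫ ω, discrepancy k o j ε⁻¹ (fun i => ENNReal.ofReal (V ω i / t)) ∂P))
    (U := fun ε => 2 * ε ^ α) (Eventually.of_forall fun _ => tendsto_const_nhds) ?_ ?_ ?_
    tendsto_const_nhds ?_
  · filter_upwards [hpos] with ε hε
    have h1 := (((hX j).tendsto_mul_left (inv_pos.2 hε)).add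
      ((hX o).tendsto_mul_left (inv_pos.2 hε))).add
        ((hlim ε⁻¹ (inv_pos.2 hε).le).const_mul 2)
    rw [Real.inv_rpow hε.le, Real.rpow_neg hε.le, inv_inv] at h1
    convert h1 using 2
    ring
  · filter_upwards with ε
    filter_upwards [eventually_gt_atTop 0] with t ht
    exact mul_nonneg (Real.rpow_nonneg ht.le _) measureReal_nonneg
  · filter_upwards [hpos] with ε hε
    filter_upwards [eventually_gt_atTop 0] with t ht
    have hL : 0 < ε⁻¹ := inv_pos.2 hε
    have hVm : Measurable fun ω i => ENNReal.ofReal (V ω i / t) :=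
      measurable_pi_lambda _ fun i =>
        (((measurable_pi_apply i).comp hμ.measurable).div_const t).ennreal_ofReal
    have hint' :
        Integrable (fun ω => discrepancy k o j ε⁻¹ (fun i => ENNReal.ofReal (V ω i / t))) P := by
      have hcont := continuous_discrepancy k o j ε⁻¹
      obtain ⟨b, hb⟩ := isCompact_univ.exists_bound_of_continuousOn hcont.continuousOn
      exact Integrable.of_bound (hcont.measurable.comp hVm).aestronglyMeasurable b
        (ae_of_all _ fun ω => hb _ (Set.mem_univ _))
    have hmarkov := mul_meas_ge_le_integral_of_nonneg
      (ae_of_all P fun ω => discrepancy_nonneg k o j ε⁻¹ _) hint' (1 / 2)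
    have hsub : P.real {ω | t < |V ω j / k j - V ω o / k o|} ≤
        P.real {ω | ε⁻¹ * t < V ω j / k j} + P.real {ω | ε⁻¹ * t < V ω o / k o} +
          P.real {ω | 1 / 2 ≤ discrepancy k o j ε⁻¹ (fun i => ENNReal.ofReal (V ω i / t))} := by
      refine le_trans ?_ ((measureReal_union_le _ _).trans
        (add_le_add_left (measureReal_union_le _ _) _))
      refine ENNReal.toReal_mono (measure_ne_top _ _) (measure_mono_ae ?_)
      filter_upwards [hμ.nonneg] with ω hω (hlt : t < |V ω j / k j - V ω o / k o|)
      by_contra hcon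
      obtain ⟨hcon, h3⟩ := not_or.1 hcon
      obtain ⟨h1, h2⟩ := not_or.1 hcon
      have h1 : V ω j / k j ≤ ε⁻¹ * t := not_lt.1 h1
      have h2 : V ω o / k o ≤ ε⁻¹ * t := not_lt.1 h2
      have h3 : ¬ 1 / 2 ≤ discrepancy k o j ε⁻¹ (fun i => ENNReal.ofReal (V ω i / t)) := h3
      refine h3 (le_trans ?_ (le_discrepancy k o j ε⁻¹ _))
      have e : ∀ i, V ω i / k i ≤ ε⁻¹ * t →
          truncatedCoord (k i) ε⁻¹ (ENNReal.ofReal (V ω i / t)) = V ω i / k i / t := by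
        intro i hi
        rw [truncatedCoord_ofReal (hk i) hL.le (div_nonneg (hω i) ht.le), div_right_comm,
          min_eq_left ((div_le_iff₀ ht).2 hi)]
      rw [e j h1, e o h2, ← sub_div, abs_div, abs_of_pos ht]
      have : 1 ≤ |V ω j / k j - V ω o / k o| / t := (one_le_div ht).2 hlt.le
      linarith
    have htα : 0 ≤ t ^ α := Real.rpow_nonneg ht.le _
    have := mul_le_mul_of_nonneg_left hsub htα
    have h4 := mul_le_mul_of_nonneg_left hmarkov htα
    nlinarith
  · have : ContinuousAt (fun ε : ℝ => 2 * ε ^ α) 0 :=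
      continuousAt_const.mul (Real.continuousAt_rpow_const _ _ (Or.inr hα.le))
    simpa [Real.zero_rpow hα.ne'] using this.tendsto.mono_left nhdsWithin_le_nhds

end Intensity

/-- A continuous ramp in the coordinate `x ∈ [0,∞]` in units of `k`, from the value `0` at level `a`
to the value `1` at level `b`. -/
noncomputable def coordRamp (k a b : ℝ) (x : ℝ≥0∞) : ℝ :=
  max (truncatedCoord k b x - a) 0 / (b - a)

section Ramp

variable {k a b : ℝ}

theorem continuous_coordRamp : Continuous (coordRamp k a b) :=
  (((continuous_truncatedCoord k b).sub continuous_const).max continuous_const).div_const _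

theorem coordRamp_nonneg (hab : a < b) (x : ℝ≥0∞) : 0 ≤ coordRamp k a b x :=
  div_nonneg (le_max_right _ _) (sub_pos.2 hab).le

theorem eventually_coordRamp_eq_zero (ha : 0 < a) : ∀ᶠ x in 𝓝 0, coordRamp k a b x = 0 := by
  have := (continuous_truncatedCoord k b).tendsto 0
  rw [truncatedCoord_zero] at this
  filter_upwards [(tendsto_order.1 this).2 a ha] with x hx
  rw [coordRamp, max_eq_right (by linarith), zero_div]

theorem coordRamp_ofReal (hk : 0 < k) (hb : 0 ≤ b) {s : ℝ} (hs : 0 ≤ s) :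
    coordRamp k a b (ENNReal.ofReal (s * k)) = max (min s b - a) 0 / (b - a) := by
  rw [coordRamp, truncatedCoord_ofReal hk hb (mul_nonneg hs hk.le),
    mul_div_cancel_right₀ _ hk.ne']

theorem ite_le_coordRamp (hk : 0 < k) (hb : 0 ≤ b) (hab : a < b) {s : ℝ} (hs : 0 ≤ s) :
    (if b < s then (1 : ℝ) else 0) ≤ coordRamp k a b (ENNReal.ofReal (s * k)) := by
  have hba : 0 < b - a := sub_pos.2 hab
  rw [coordRamp_ofReal hk hb hs]
  split_ifs with h
  · rw [min_eq_right h.le, max_eq_left hba.le, div_self hba.ne']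
  · positivity

theorem coordRamp_le_ite (hk : 0 < k) (hb : 0 ≤ b) (hab : a < b) {s : ℝ} (hs : 0 ≤ s) :
    coordRamp k a b (ENNReal.ofReal (s * k)) ≤ if a < s then (1 : ℝ) else 0 := by
  have hba : 0 < b - a := sub_pos.2 hab
  rw [coordRamp_ofReal hk hb hs]
  split_ifs with h
  · rw [div_le_one hba]
    exact max_le (by linarith [min_le_right s b]) hba.le
  · rw [max_eq_right (by linarith [min_le_left s b, not_lt.1 h]), zero_div]

end Ramp

/-! ### One-factor structure of a fully dependent vector -/

section OneFactor

variable {Ω : Type*} [MeasurableSpace Ω] {P : Measure Ω} [IsProbabilityMeasure P] {d : ℕ}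
  {N : Seminorm ℝ (Fin d → ℝ)} {V : Ω → Fin d → ℝ} {μ : Measure (PuncturedOrthant d)}
  {α : ℝ} {k : Fin d → ℝ}

/-- Up to a term with negligible tail, `M V` is the multiple of the deterministic vector `M k` by
the scalar factor `V_o / k_o`. -/
theorem IsIntensityMeasure.hasPowerTail_mulVec_sub
    (hμ : IsIntensityMeasure P V (outsideUnitBall N) μ) (hN : IsUnitNorm N) (hk : ∀ j, 0 < k j)
    (hα : 0 < α) (hV : ∀ j, HasPowerTail P α (fun ω => V ω j) (k j ^ α))
    (hline : μ {x | ∃ s : ℝ, 0 < s ∧ ∀ j, x.1 j = ENNReal.ofReal (s * k j)}ᶜ = 0)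
    (o : Fin d) {q : ℕ} {N' : Seminorm ℝ (Fin q → ℝ)} (hN' : IsUnitNorm N')
    (M : Matrix (Fin q) (Fin d) ℝ) :
    HasPowerTail P α (fun ω => N' (M *ᵥ V ω - (V ω o / k o) • (M *ᵥ k))) 0 := by
  refine HasPowerTail.zero_seminorm hN' fun i => ?_
  have hterm : ∀ j, HasPowerTail P α
      (fun ω => |M i j| * k j * |V ω j / k j - V ω o / k o|) 0 := by
    intro j
    rcases (mul_nonneg (abs_nonneg (M i j)) (hk j).le).eq_or_lt with h | h
    · simpa [← h] using HasPowerTail.zero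
    · simpa using (hμ.hasPowerTail_sub hN hk hα hV hline o j).const_mul h
  refine (HasPowerTail.zero_sum Finset.univ (fun j ω => ?_) hterm).zero_mono
    (ae_of_all _ fun ω => ?_)
  · exact mul_nonneg (mul_nonneg (abs_nonneg _) (hk j).le) (abs_nonneg _)
  · rw [abs_abs]
    have e : (M *ᵥ V ω - (V ω o / k o) • (M *ᵥ k)) i
        = ∑ j, M i j * (k j * (V ω j / k j - V ω o / k o)) := by
      simp only [Pi.sub_apply, Pi.smul_apply, Matrix.mulVec, dotProduct, smul_eq_mul,
        Finset.mul_sum, ← Finset.sum_sub_distrib]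
      refine Finset.sum_congr rfl fun j _ => ?_
      rw [mul_sub, mul_div_cancel₀ _ (hk j).ne']
      ring
    rw [e]
    refine (Finset.abs_sum_le_sum_abs _ _).trans (Finset.sum_le_sum fun j _ => ?_)
    rw [abs_mul, abs_mul, abs_of_pos (hk j), mul_assoc]

/-- The norm of `V` behaves as if `V` were exactly the multiple `V_o / k_o` of `k`. -/
theorem IsIntensityMeasure.hasPowerTail_norm
    (hμ : IsIntensityMeasure P V (outsideUnitBall N) μ) (hN : IsUnitNorm N) (hk : ∀ j, 0 < k j)
    (hα : 0 < α) (hV : ∀ j, HasPowerTail P α (fun ω => V ω j) (k j ^ α))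
    (hline : μ {x | ∃ s : ℝ, 0 < s ∧ ∀ j, x.1 j = ENNReal.ofReal (s * k j)}ᶜ = 0)
    (o : Fin d) : HasPowerTail P α (fun ω => N (V ω)) (N k ^ α) := by
  have hk0 : k ≠ 0 := fun h => (hk o).ne' (congrFun h o)
  have h := (((hV o).div_const_one (hk o)).const_mul (hN.pos hk0)).of_abs_sub_le
    (Y := fun ω => N (V ω)) (hμ.hasPowerTail_mulVec_sub hN hk hα hV hline o hN 1) (by
      filter_upwards [hμ.nonneg] with ω hω
      have := abs_sub_map_le_sub N (V ω) ((V ω o / k o) • k)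
      rw [map_smul_eq_mul, Real.norm_of_nonneg (div_nonneg (hω o) (hk o).le), mul_comm] at this
      simpa only [Matrix.one_mulVec] using this)
  simpa using h

/-- The limit of the normalized averages of the ramp lies between the two values of the power law
at the ends of the ramp. -/
theorem IsIntensityMeasure.integral_coordRamp_mem_Icc
    (hμ : IsIntensityMeasure P V (outsideUnitBall N) μ) (hN : IsUnitNorm N) (hk : ∀ j, 0 < k j)
    (hα : 0 < α) (hV : ∀ j, HasPowerTail P α (fun ω => V ω j) (k j ^ α))
    (hline : μ {x | ∃ s : ℝ, 0 < s ∧ ∀ j, x.1 j = ENNReal.ofReal (s * k j)}ᶜ = 0)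
    (o : Fin d) {a b : ℝ} (ha : 0 < a) (hab : a < b) :
    ∫ x, coordRamp (k o) a b (x.1 o) ∂μ ∈
      Set.Icc (b ^ (-α) * (N k ^ α)⁻¹) (a ^ (-α) * (N k ^ α)⁻¹) := by
  have hb : 0 < b := ha.trans hab
  have hk0 : k ≠ 0 := fun h => (hk o).ne' (congrFun h o)
  have hNk : 0 < N k ^ α := Real.rpow_pos_of_pos (hN.pos hk0) _
  have hgc : Continuous fun x : Fin d → ℝ≥0∞ => coordRamp (k o) a b (x o) :=
    continuous_coordRamp.comp (continuous_apply o)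
  have hg := hμ.tendsto_integral hgc
    ((continuous_apply o).tendsto (0 : Fin d → ℝ≥0∞) (eventually_coordRamp_eq_zero ha))
  have hR : HasPowerTail P α (fun ω => V ω o / k o) 1 := (hV o).div_const_one (hk o)
  have hratio : ∀ c > 0, Tendsto (fun t : ℝ => (P.real {ω | t < N (V ω)})⁻¹ *
      P.real {ω | c * t < V ω o / k o}) atTop (𝓝 (c ^ (-α) * (N k ^ α)⁻¹)) := by
    intro c hc
    have h := (hR.tendsto_mul_left hc).mul
      ((hμ.hasPowerTail_norm hN hk hα hV hline o).inv₀ hNk.ne')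
    rw [mul_one] at h
    refine h.congr' ?_
    filter_upwards [eventually_gt_atTop 0] with t ht
    have : t ^ α ≠ 0 := (Real.rpow_pos_of_pos ht _).ne'
    rw [mul_inv, mul_mul_mul_comm, mul_inv_cancel₀ this, one_mul, mul_comm]
  have hVo : Measurable fun ω => V ω o := (measurable_pi_apply o).comp hμ.measurable
  obtain ⟨C, hC⟩ := isCompact_univ.exists_bound_of_continuousOn
    (continuous_coordRamp (k := k o) (a := a) (b := b)).continuousOn
  have hint : ∀ t, Integrable (fun ω => coordRamp (k o) a b (ENNReal.ofReal (V ω o / t))) P :=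
    fun t => Integrable.of_bound (continuous_coordRamp.measurable.comp
      (hVo.div_const t).ennreal_ofReal).aestronglyMeasurable C
        (ae_of_all _ fun ω => hC _ (Set.mem_univ _))
  have hset : ∀ c t, MeasurableSet {ω | c * t < V ω o / k o} := fun c t =>
    measurableSet_lt measurable_const (hVo.div_const (k o))
  have hind : ∀ c t, ∫ ω, {ω | c * t < V ω o / k o}.indicator (fun _ => (1 : ℝ)) ω ∂P
      = P.real {ω | c * t < V ω o / k o} := by
    intro c t
    rw [integral_indicator_const _ (hset c t), smul_eq_mul, mul_one]
  have hindeq : ∀ c t ω, 0 < t → {ω | c * t < V ω o / k o}.indicator (fun _ => (1 : ℝ)) ω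
      = if c < V ω o / k o / t then 1 else 0 := by
    intro c t ω ht
    simp only [Set.indicator_apply, Set.mem_ofPred_eq, lt_div_iff₀ ht]
  have hs : ∀ t > 0, ∀ ω, V ω o / t = V ω o / k o / t * k o := by
    intro t ht ω
    rw [div_right_comm, div_mul_cancel₀ _ (hk o).ne']
  constructor
  · refine le_of_tendsto_of_tendsto (hratio b hb) hg ?_
    filter_upwards [eventually_gt_atTop 0] with t ht
    refine mul_le_mul_of_nonneg_left ?_ (inv_nonneg.2 measureReal_nonneg)
    rw [← hind]
    refine integral_mono_ae ((integrable_const _).indicator (hset b t)) (hint t) ?_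
    filter_upwards [hμ.nonneg] with ω hω
    rw [hindeq b t ω ht, hs t ht]
    exact ite_le_coordRamp (hk o) hb.le hab (div_nonneg (div_nonneg (hω o) (hk o).le) ht.le)
  · refine le_of_tendsto_of_tendsto hg (hratio a ha) ?_
    filter_upwards [eventually_gt_atTop 0] with t ht
    refine mul_le_mul_of_nonneg_left ?_ (inv_nonneg.2 measureReal_nonneg)
    rw [← hind]
    refine integral_mono_ae (hint t) ((integrable_const _).indicator (hset a t)) ?_
    filter_upwards [hμ.nonneg] with ω hω
    rw [hindeq a t ω ht, hs t ht]
    exact coordRamp_le_ite (hk o) hb.le hab (div_nonneg (div_nonneg (hω o) (hk o).le) ht.le)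

/-- The intensity measure of a fully dependent vector has a power-law radial part. -/
theorem IsIntensityMeasure.apply_ray
    (hμ : IsIntensityMeasure P V (outsideUnitBall N) μ) (hN : IsUnitNorm N) (hk : ∀ j, 0 < k j)
    (hα : 0 < α) (hV : ∀ j, HasPowerTail P α (fun ω => V ω j) (k j ^ α))
    (hline : μ {x | ∃ s : ℝ, 0 < s ∧ ∀ j, x.1 j = ENNReal.ofReal (s * k j)}ᶜ = 0)
    (o : Fin d) {r : ℝ} (hr : 0 < r) :
    μ {x | ∃ s : ℝ, r < s ∧ ∀ j, x.1 j = ENNReal.ofReal (s * k j)}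
      = ENNReal.ofReal (r ^ (-α) * (N k ^ α)⁻¹) := by
  have := hμ.radon
  have hk0 : k ≠ 0 := fun h => (hk o).ne' (congrFun h o)
  have hNk : 0 < N k ^ α := Real.rpow_pos_of_pos (hN.pos hk0) _
  let H : ℝ → Set (PuncturedOrthant d) := fun a => {x | ENNReal.ofReal (a * k o) < x.1 o}
  have hHm : ∀ a, MeasurableSet (H a) := fun a =>
    measurableSet_lt measurable_const ((measurable_pi_apply o).comp measurable_subtype_coe)
  have hray : ∀ a > 0, {x : PuncturedOrthant d |
      ∃ s : ℝ, a < s ∧ ∀ j, x.1 j = ENNReal.ofReal (s * k j)} =ᵐ[μ] H a := by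
    intro a ha
    filter_upwards [compl_mem_ae_iff.2 hline] with x hx
    obtain ⟨s, hs, hx⟩ := not_not.1 hx
    have hsH : x ∈ H a ↔ a < s := by
      change ENNReal.ofReal (a * k o) < x.1 o ↔ a < s
      rw [hx o, ENNReal.ofReal_lt_ofReal_iff (mul_pos hs (hk o)), mul_lt_mul_iff_left₀ (hk o)]
    refine propext ⟨?_, fun h => ⟨s, hsH.1 h, hx⟩⟩
    rintro ⟨s', hs', hx'⟩
    have : s' = s := by
      have h := (hx' o).symm.trans (hx o)
      rw [ENNReal.ofReal_eq_ofReal_iff (mul_pos (ha.trans hs') (hk o)).le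
        (mul_pos hs (hk o)).le] at h
      exact mul_right_cancel₀ (hk o).ne' h
    exact hsH.2 (this ▸ hs')
  have hHfin : ∀ a > 0, μ (H a) < ∞ := by
    intro a ha
    have hpos : 0 < ENNReal.ofReal (a * k o) := ENNReal.ofReal_pos.2 (mul_pos ha (hk o))
    have hsub : H a ⊆ Subtype.val ⁻¹' {x : Fin d → ℝ≥0∞ | ENNReal.ofReal (a * k o) ≤ x o} :=
      fun x hx => show ENNReal.ofReal (a * k o) ≤ x.1 o from le_of_lt hx
    exact (measure_mono hsub).trans_lt (isCompact_punctured_preimage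
      (isClosed_le continuous_const (continuous_apply o)) (not_le.2 hpos)).measure_lt_top
  have hindμ : ∀ c, ∫ x, (H c).indicator (fun _ => (1 : ℝ)) x ∂μ = μ.real (H c) := by
    intro c
    rw [integral_indicator_const _ (hHm c), smul_eq_mul, mul_one]
  have hindint : ∀ c > 0, Integrable ((H c).indicator fun _ => (1 : ℝ)) μ := fun c hc =>
    (integrable_indicator_iff (hHm c)).2 (integrableOn_const (hHfin c hc).ne)
  have hHeq : ∀ (c : ℝ) (x : PuncturedOrthant d) (s : ℝ), 0 < s →
      x.1 o = ENNReal.ofReal (s * k o) →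
      (H c).indicator (fun _ => (1 : ℝ)) x = if c < s then 1 else 0 := by
    intro c x s hs hx
    have : x ∈ H c ↔ c < s := by
      change ENNReal.ofReal (c * k o) < x.1 o ↔ c < s
      rw [hx, ENNReal.ofReal_lt_ofReal_iff (mul_pos hs (hk o)), mul_lt_mul_iff_left₀ (hk o)]
    simp only [Set.indicator_apply, this]
  -- The ramp between the levels `a` and `b` lies between the indicators of `H b` and `H a`.
  have key : ∀ a b, 0 < a → a < b → μ.real (H b) ≤ a ^ (-α) * (N k ^ α)⁻¹ ∧
      b ^ (-α) * (N k ^ α)⁻¹ ≤ μ.real (H a) := by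
    intro a b ha hab
    have hb : 0 < b := ha.trans hab
    obtain ⟨hlow, hup⟩ := hμ.integral_coordRamp_mem_Icc hN hk hα hV hline o ha hab
    have hgup : ∀ᵐ x ∂μ, coordRamp (k o) a b (x.1 o) ≤ (H a).indicator (fun _ => (1 : ℝ)) x := by
      filter_upwards [compl_mem_ae_iff.2 hline] with x hx
      obtain ⟨s, hs, hx⟩ := not_not.1 hx
      rw [hHeq a x s hs (hx o), hx o]
      exact coordRamp_le_ite (hk o) hb.le hab hs.le
    have hglow : ∀ᵐ x ∂μ, (H b).indicator (fun _ => (1 : ℝ)) x ≤ coordRamp (k o) a b (x.1 o) := by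
      filter_upwards [compl_mem_ae_iff.2 hline] with x hx
      obtain ⟨s, hs, hx⟩ := not_not.1 hx
      rw [hHeq b x s hs (hx o), hx o]
      exact ite_le_coordRamp (hk o) hb.le hab hs.le
    have hgint : Integrable (fun x : PuncturedOrthant d => coordRamp (k o) a b (x.1 o)) μ := by
      refine (hindint a ha).mono' (continuous_coordRamp.measurable.comp
        ((measurable_pi_apply o).comp measurable_subtype_coe)).aestronglyMeasurable
        (hgup.mono fun x hx => ?_)
      rwa [Real.norm_of_nonneg (coordRamp_nonneg hab _)]
    rw [← hindμ b, ← hindμ a]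
    exact ⟨(integral_mono_ae (hindint b hb) hgint hglow).trans hup,
      hlow.trans (integral_mono_ae hgint (hindint a ha) hgup)⟩
  have hcontr : Tendsto (fun a : ℝ => a ^ (-α) * (N k ^ α)⁻¹) (𝓝 r)
      (𝓝 (r ^ (-α) * (N k ^ α)⁻¹)) :=
    ((Real.continuousAt_rpow_const _ _ (Or.inl hr.ne')).mul continuousAt_const).tendsto
  rw [measure_congr (hray r hr), ← ENNReal.ofReal_toReal (hHfin r hr).ne]
  congr 1
  refine le_antisymm ?_ ?_
  · refine ge_of_tendsto (hcontr.mono_left (nhdsWithin_le_nhds (s := Set.Iio r))) ?_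
    filter_upwards [self_mem_nhdsWithin,
      nhdsWithin_le_nhds (lt_mem_nhds hr : ∀ᶠ a in 𝓝 r, 0 < a)] with a har ha
    exact (key a r ha har).1
  · refine le_of_tendsto (hcontr.mono_left (nhdsWithin_le_nhds (s := Set.Ioi r))) ?_
    filter_upwards [self_mem_nhdsWithin] with b hb
    exact (key r b hr hb).2

end OneFactor

/-! ### Conditioning on a finite-valued independent variable -/

theorem Matrix.mulVec_apply_nonneg {q d : ℕ} {M : Matrix (Fin q) (Fin d) ℝ}
    (hM : ∀ i j, 0 ≤ M i j) {v : Fin d → ℝ} (hv : ∀ j, 0 ≤ v j) (i : Fin q) : 0 ≤ (M *ᵥ v) i := by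
  change 0 ≤ ∑ j, M i j * v j
  exact Finset.sum_nonneg fun j _ => mul_nonneg (hM i j) (hv j)

theorem Matrix.mulVec_eq_zero_iff_of_pos {q d : ℕ} {M : Matrix (Fin q) (Fin d) ℝ}
    (hM : ∀ i j, 0 ≤ M i j) {v : Fin d → ℝ} (hv : ∀ j, 0 < v j) : M *ᵥ v = 0 ↔ M = 0 := by
  refine ⟨fun h => ?_, fun h => by simp [h]⟩
  ext i j
  have hi : ∑ j, M i j * v j = 0 := congrFun h i
  have := (Finset.sum_eq_zero_iff_of_nonneg fun j _ => mul_nonneg (hM i j) (hv j).le).1 hi j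
    (Finset.mem_univ j)
  exact (mul_eq_zero.1 this).resolve_right (hv j).ne'

section Mixture

variable {Ω : Type*} [MeasurableSpace Ω] {P : Measure Ω}
  {Γ : Type*} [Fintype Γ] [MeasurableSpace Γ] [MeasurableSingletonClass Γ] {G : Ω → Γ}

theorem lintegral_comp_eq_sum (hG : Measurable G) (f : Γ → ℝ≥0∞) :
    ∫⁻ ω, f (G ω) ∂P = ∑ g, P {ω | G ω = g} * f g := by
  rw [← lintegral_map (measurable_of_finite f) hG, lintegral_fintype]
  refine Finset.sum_congr rfl fun g _ => ?_
  rw [Measure.map_apply hG (measurableSet_singleton g), mul_comm]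
  rfl

/-- Averages over an independent pair, one of whose members has finitely many values, are computed
by conditioning on that member. -/
theorem ProbabilityTheory.IndepFun.integral_eq_sum {E : Type*} [MeasurableSpace E] {V : Ω → E}
    (h : IndepFun V G P) (hG : Measurable G) {ψ : Γ → E → ℝ}
    (hψ : ∀ g, Measurable (ψ g)) (hint : ∀ g, Integrable (fun ω => ψ g (V ω)) P) :
    ∫ ω, ψ (G ω) (V ω) ∂P = ∑ g, P.real {ω | G ω = g} * ∫ ω, ψ g (V ω) ∂P := by
  classical
  have hGm : ∀ g, MeasurableSet {ω | G ω = g} := fun g => hG (measurableSet_singleton g)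
  have hsplit : ∀ ω, ψ (G ω) (V ω)
      = ∑ g, {ω | G ω = g}.indicator (fun ω => ψ g (V ω)) ω := by
    intro ω
    rw [Finset.sum_eq_single (G ω)]
    · simp
    · intro g _ hg
      exact Set.indicator_of_notMem (fun h => hg h.symm) _
    · simp
  simp_rw [hsplit]
  rw [integral_finsetSum _ fun g _ => (hint g).indicator (hGm g)]
  refine Finset.sum_congr rfl fun g _ => ?_
  have hindep : IndepFun (fun ω => ({g} : Set Γ).indicator (fun _ => (1 : ℝ)) (G ω))
      (fun ω => ψ g (V ω)) P :=
    (h.comp (hψ g) (measurable_of_finite (({g} : Set Γ).indicator fun _ => (1 : ℝ)))).symm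
  have hprod := hindep.integral_fun_mul_eq_mul_integral
    ((measurable_of_finite (({g} : Set Γ).indicator fun _ => (1 : ℝ))).comp
      hG).aestronglyMeasurable (hint g).aestronglyMeasurable
  have e1 : ∫ ω, ({g} : Set Γ).indicator (fun _ => (1 : ℝ)) (G ω) ∂P = P.real {ω | G ω = g} := by
    have : (fun ω => ({g} : Set Γ).indicator (fun _ => (1 : ℝ)) (G ω))
        = {ω | G ω = g}.indicator fun _ => (1 : ℝ) := by
      ext ω
      simp [Set.indicator_apply]
    rw [this, integral_indicator_const _ (hGm g), smul_eq_mul, mul_one]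
  rw [e1] at hprod
  rw [← hprod]
  refine integral_congr_ae (ae_of_all _ fun ω => ?_)
  by_cases hω : G ω = g <;> simp [hω]

variable [IsProbabilityMeasure P]

theorem integral_comp_eq_sum (hG : Measurable G) (f : Γ → ℝ) :
    ∫ ω, f (G ω) ∂P = ∑ g, P.real {ω | G ω = g} * f g := by
  have := Measure.isProbabilityMeasure_map (μ := P) hG.aemeasurable
  rw [← integral_map hG.aemeasurable (measurable_of_finite f).aestronglyMeasurable,
    integral_fintype .of_finite]
  refine Finset.sum_congr rfl fun g _ => ?_
  rw [map_measureReal_apply hG (measurableSet_singleton g)]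
  rfl

/-- Limits of averages over `{‖M_G V‖ > t}` of a function `φ` of `M_G V`, where `V` is fully
dependent and `M_G` is an independent random matrix with finitely many values: each value `M_g`
contributes its single limit direction, that of `M_g k`, in which `φ` has the limit `c g`. -/
theorem IsIntensityMeasure.tendsto_setIntegral_mixture {q d : ℕ}
    {N : Seminorm ℝ (Fin d → ℝ)} {V : Ω → Fin d → ℝ} {μ : Measure (PuncturedOrthant d)}
    {α : ℝ} {k : Fin d → ℝ}
    (hμ : IsIntensityMeasure P V (outsideUnitBall N) μ) (hN : IsUnitNorm N) (hk : ∀ j, 0 < k j)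
    (hα : 0 < α) (hV : ∀ j, HasPowerTail P α (fun ω => V ω j) (k j ^ α))
    (hline : μ {x | ∃ s : ℝ, 0 < s ∧ ∀ j, x.1 j = ENNReal.ofReal (s * k j)}ᶜ = 0)
    (o : Fin d) {N' : Seminorm ℝ (Fin q → ℝ)} (hN' : IsUnitNorm N')
    {M : Γ → Matrix (Fin q) (Fin d) ℝ} (hM : ∀ g i j, 0 ≤ M g i j)
    (hG : Measurable G) (hindep : IndepFun V G P)
    {φ : (Fin q → ℝ) → ℝ} (hφ : Measurable φ) {C : ℝ} (hC : ∀ x, |φ x| ≤ C) {c : Γ → ℝ}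
    (hc : ∀ g, 0 < N' (M g *ᵥ k) → ∀ δ > 0, ∃ η > 0, ∀ x : Fin q → ℝ, (∀ i, 0 ≤ x i) →
      0 < N' x → N' ((N' x)⁻¹ • x - (N' (M g *ᵥ k))⁻¹ • (M g *ᵥ k)) ≤ η → |φ x - c g| ≤ δ) :
    Tendsto (fun t : ℝ => t ^ α *
        ∫ ω in {ω | t < N' (M (G ω) *ᵥ V ω)}, φ (M (G ω) *ᵥ V ω) ∂P) atTop
      (𝓝 (∑ g, P.real {ω | G ω = g} * (N' (M g *ᵥ k) ^ α * c g))) := by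
  have hmul : ∀ g, Measurable fun v : Fin d → ℝ => M g *ᵥ v := fun g =>
    (Continuous.matrix_mulVec continuous_const continuous_id).measurable
  have hNm : ∀ g, Measurable fun v : Fin d → ℝ => N' (M g *ᵥ v) := fun g =>
    hN'.continuous.measurable.comp (hmul g)
  have hNV : ∀ g t, MeasurableSet {ω | t < N' (M g *ᵥ V ω)} := fun g t =>
    measurableSet_lt measurable_const ((hNm g).comp hμ.measurable)
  have hsplit : ∀ t : ℝ, ∫ ω in {ω | t < N' (M (G ω) *ᵥ V ω)}, φ (M (G ω) *ᵥ V ω) ∂P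
      = ∑ g, P.real {ω | G ω = g} * ∫ ω in {ω | t < N' (M g *ᵥ V ω)}, φ (M g *ᵥ V ω) ∂P := by
    intro t
    have hSm : MeasurableSet {ω | t < N' (M (G ω) *ᵥ V ω)} := by
      have : {ω | t < N' (M (G ω) *ᵥ V ω)}
          = ⋃ g, ({ω | G ω = g} ∩ {ω | t < N' (M g *ᵥ V ω)}) := by
        ext ω
        simp
      rw [this]
      exact MeasurableSet.iUnion fun g => (hG (measurableSet_singleton g)).inter (hNV g t)
    have h := hindep.integral_eq_sum hG
      (ψ := fun g => {v : Fin d → ℝ | t < N' (M g *ᵥ v)}.indicator fun v => φ (M g *ᵥ v))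
      (fun g => (hφ.comp (hmul g)).indicator (measurableSet_lt measurable_const (hNm g)))
      (fun g => (Integrable.of_bound ((hφ.comp ((hmul g).comp hμ.measurable))).aestronglyMeasurable
        C (ae_of_all _ fun ω => hC _)).indicator (hNV g t))
    rw [← integral_indicator hSm]
    refine Eq.trans ?_ (h.trans (Finset.sum_congr rfl fun g _ => ?_))
    · rfl
    · rw [← integral_indicator (hNV g t)]
      rfl
  have hlim : Tendsto (fun t : ℝ => ∑ g, P.real {ω | G ω = g} * (t ^ α *
      ∫ ω in {ω | t < N' (M g *ᵥ V ω)}, φ (M g *ᵥ V ω) ∂P)) atTop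
      (𝓝 (∑ g, P.real {ω | G ω = g} * (N' (M g *ᵥ k) ^ α * c g))) := by
    refine tendsto_finsetSum _ fun g _ => Tendsto.const_mul _ ?_
    by_cases hw : M g *ᵥ k = 0
    · rw [hw, map_zero, Real.zero_rpow hα.ne', zero_mul]
      refine tendsto_const_nhds.congr' ?_
      filter_upwards [eventually_gt_atTop 0] with t ht
      have : {ω | t < N' (M g *ᵥ V ω)} = ∅ := by
        refine Set.eq_empty_of_forall_notMem fun ω (h : t < N' (M g *ᵥ V ω)) => ?_
        rw [(Matrix.mulVec_eq_zero_iff_of_pos (hM g) hk).1 hw, Matrix.zero_mulVec, map_zero] at h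
        exact h.not_gt ht
      simp [this]
    · have hw' := hN'.pos hw
      refine HasPowerTail.tendsto_setIntegral (R := fun ω => V ω o / k o) hN'
        ((hmul g).comp hμ.measurable) ?_ ?_ hw' ((hV o).div_const_one (hk o))
        (hμ.hasPowerTail_mulVec_sub hN hk hα hV hline o hN' (M g)) hφ hC (hc g hw')
      · filter_upwards [hμ.nonneg] with ω hω i
        exact Matrix.mulVec_apply_nonneg (hM g) hω i
      · filter_upwards [hμ.nonneg] with ω hω
        exact div_nonneg (hω o) (hk o).le
  refine hlim.congr fun t => ?_
  rw [hsplit, Finset.mul_sum]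
  exact Finset.sum_congr rfl fun g _ => by ring

end Mixture

/-! ### Spectral measures -/

section Spectral

variable {Ω : Type*} [MeasurableSpace Ω] {P : Measure Ω} {n : ℕ} {N : Seminorm ℝ (Fin n → ℝ)}

/-- A function on the positive sphere as a function of the direction of a vector (zero where the
vector has no direction in the positive sphere). -/
noncomputable def directional (f : PositiveSphere N → ℝ) (x : Fin n → ℝ) : ℝ :=
  Function.extend Subtype.val f 0 ((N x)⁻¹ • x)

theorem IsUnitNorm.measurableSet_positiveSphere (hN : IsUnitNorm N) :
    MeasurableSet {x : Fin n → ℝ | (∀ i, 0 ≤ x i) ∧ N x = 1} :=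
  hN.isCompact_positiveSphere.measurableSet

theorem IsUnitNorm.measurable_direction (hN : IsUnitNorm N) :
    Measurable fun x : Fin n → ℝ => (N x)⁻¹ • x :=
  hN.continuous.measurable.inv.smul measurable_id

theorem measurable_extend_positiveSphere (hN : IsUnitNorm N) {f : PositiveSphere N → ℝ}
    (hf : Measurable f) : Measurable (Function.extend Subtype.val f (0 : (Fin n → ℝ) → ℝ)) :=
  (MeasurableEmbedding.subtype_coe hN.measurableSet_positiveSphere).measurable_extend hf
    measurable_zero

theorem directional_apply (f : PositiveSphere N → ℝ) {x : Fin n → ℝ} {b : PositiveSphere N}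
    (hb : b.1 = (N x)⁻¹ • x) : directional f x = f b := by
  rw [directional, ← hb]
  exact Subtype.val_injective.extend_apply _ _ _

theorem direction_mem_positiveSphere {x : Fin n → ℝ} (hx : ∀ i, 0 ≤ x i) (hN : 0 < N x) :
    (∀ i, 0 ≤ ((N x)⁻¹ • x) i) ∧ N ((N x)⁻¹ • x) = 1 :=
  ⟨fun i => mul_nonneg (inv_nonneg.2 hN.le) (hx i), by
    rw [map_smul_eq_mul, norm_inv, Real.norm_of_nonneg hN.le, inv_mul_cancel₀ hN.ne']⟩

theorem abs_directional_le {f : PositiveSphere N → ℝ} {C : ℝ} (hC0 : 0 ≤ C)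
    (hC : ∀ b, |f b| ≤ C) (x : Fin n → ℝ) : |directional f x| ≤ C := by
  by_cases h : ∃ b : PositiveSphere N, b.1 = (N x)⁻¹ • x
  · obtain ⟨b, hb⟩ := h
    rw [directional_apply f hb]
    exact hC b
  · rw [directional, Function.extend_apply' _ _ _ h]
    simpa using hC0

/-- Near the direction of `w`, a continuous function of the direction is close to its value there.
This transfers continuity in the subspace topology of the sphere to the norm `N`. -/
theorem directional_near (hN : IsUnitNorm N) {f : PositiveSphere N → ℝ} (hf : Continuous f)
    {w : Fin n → ℝ} {b : PositiveSphere N} (hb : b.1 = (N w)⁻¹ • w) {δ : ℝ} (hδ : 0 < δ) :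
    ∃ η > 0, ∀ x : Fin n → ℝ, (∀ i, 0 ≤ x i) → 0 < N x →
      N ((N x)⁻¹ • x - (N w)⁻¹ • w) ≤ η → |directional f x - f b| ≤ δ := by
  obtain ⟨c, hc, hcN⟩ := hN.exists_mul_norm_le
  obtain ⟨η, hη, hfη⟩ := Metric.continuousAt_iff.1 hf.continuousAt δ hδ
  refine ⟨c * η / 2, by positivity, fun x hx hNx hle => ?_⟩
  rw [directional_apply f (b := ⟨_, direction_mem_positiveSphere hx hNx⟩) rfl, ← Real.dist_eq]
  refine (hfη ?_).le
  rw [Subtype.dist_eq, dist_eq_norm, hb]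
  have h := (hcN _).trans hle
  rw [mul_div_assoc, mul_le_mul_iff_right₀ hc] at h
  linarith

theorem integral_angularLaw (hN : IsUnitNorm N) {X : Ω → Fin n → ℝ} (hX : Measurable X)
    {f : PositiveSphere N → ℝ} (hf : Measurable f) (s : ℝ) :
    ∫ b, f b ∂(angularLaw P N X s) = ∫ ω in {ω | s < N (X ω)}, directional f (X ω) ∂P := by
  have hθ : Measurable fun ω => (N (X ω))⁻¹ • X ω := hN.measurable_direction.comp hX
  have hf' := measurable_extend_positiveSphere hN hf
  have he : ∀ b : PositiveSphere N, f b = Function.extend Subtype.val f 0 b.1 := fun b =>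
    (Subtype.val_injective.extend_apply _ _ _).symm
  simp_rw [he]
  rw [angularLaw, integral_subtype_comap hN.measurableSet_positiveSphere
      (Function.extend Subtype.val f 0),
    setIntegral_eq_integral_of_forall_compl_eq_zero, integral_map hθ.aemeasurable
      hf'.aestronglyMeasurable]
  · rfl
  · intro x hx
    exact Function.extend_apply' _ _ _ fun ⟨b, hb⟩ => hx (hb ▸ b.2)

/-- Spectral measures are unique, since the positive sphere is compact. -/
theorem IsSpectralMeasure.unique (hN : IsUnitNorm N) {X : Ω → Fin n → ℝ} {α : ℝ}
    {ρ ρ' : Measure (PositiveSphere N)} (h : IsSpectralMeasure P N X α ρ)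
    (h' : IsSpectralMeasure P N X α ρ') : ρ = ρ' := by
  have := hN.compactSpace_positiveSphere
  have := h.probability
  have := h'.probability
  refine ext_of_forall_integral_eq_of_IsFiniteMeasure fun f => ?_
  have h1 := h.vague 1 one_pos ⟨f.toContinuousMap, HasCompactSupport.of_compactSpace _⟩
  have h2 := h'.vague 1 one_pos ⟨f.toContinuousMap, HasCompactSupport.of_compactSpace _⟩
  have := tendsto_nhds_unique h1 h2
  simpa using this

/-- The support of a finite sum of point masses. -/
theorem support_sum_dirac {Γ Y : Type*} [Fintype Γ] [TopologicalSpace Y] [T1Space Y]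
    [MeasurableSpace Y] [OpensMeasurableSpace Y] (c : Γ → ℝ≥0∞) (θ : Γ → Y) :
    (∑ g, c g • Measure.dirac (θ g)).support = {y | ∃ g, c g ≠ 0 ∧ y = θ g} := by
  ext y
  constructor
  · contrapose!
    intro hy
    have hy : ∀ g, c g ≠ 0 → y ≠ θ g := fun g hg h => hy ⟨g, hg, h⟩
    rw [Measure.notMem_support_iff_exists]
    have hcl : IsClosed (θ '' {g | c g ≠ 0}) := (Set.toFinite _).isClosed
    refine ⟨(θ '' {g | c g ≠ 0})ᶜ, hcl.isOpen_compl.mem_nhds ?_, ?_⟩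
    · rintro ⟨g, hg, h⟩
      exact hy g hg h.symm
    · rw [Measure.finsetSum_apply]
      refine Finset.sum_eq_zero fun g _ => ?_
      rw [Measure.smul_apply, Measure.dirac_apply' _ hcl.measurableSet.compl, smul_eq_mul]
      by_cases hg : c g = 0
      · simp [hg]
      · rw [Set.indicator_of_notMem (not_not.2 ⟨g, hg, rfl⟩), mul_zero]
  · rintro ⟨g, hg, rfl⟩
    rw [Measure.mem_support_iff_forall]
    intro U hU
    obtain ⟨O, hOU, hO, hmem⟩ := mem_nhds_iff.1 hU
    refine lt_of_lt_of_le ?_ (measure_mono hOU)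
    rw [Measure.finsetSum_apply]
    refine lt_of_lt_of_le (pos_iff_ne_zero.2 ?_)
      (Finset.single_le_sum (fun _ _ => zero_le) (Finset.mem_univ g))
    rw [Measure.smul_apply, Measure.dirac_apply' _ hO.measurableSet, Set.indicator_of_mem hmem]
    simpa using hg

end Spectral

/-! ### The pushforward of the intensity measure -/

/-- The intensity measure of the cone over `B`, pulled back along a nonnegative matrix `M`: only
the direction of `M k` matters. -/
theorem IsIntensityMeasure.apply_preimage_coneOver {Ω : Type*} [MeasurableSpace Ω]
    {P : Measure Ω} [IsProbabilityMeasure P] {q d : ℕ}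
    {N : Seminorm ℝ (Fin d → ℝ)} {V : Ω → Fin d → ℝ} {μ : Measure (PuncturedOrthant d)}
    {α : ℝ} {k : Fin d → ℝ}
    (hμ : IsIntensityMeasure P V (outsideUnitBall N) μ) (hN : IsUnitNorm N) (hk : ∀ j, 0 < k j)
    (hα : 0 < α) (hV : ∀ j, HasPowerTail P α (fun ω => V ω j) (k j ^ α))
    (hline : μ {x | ∃ s : ℝ, 0 < s ∧ ∀ j, x.1 j = ENNReal.ofReal (s * k j)}ᶜ = 0)
    (o : Fin d) {N' : Seminorm ℝ (Fin q → ℝ)}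
    {M : Matrix (Fin q) (Fin d) ℝ} (hM : ∀ i j, 0 ≤ M i j) {b : PositiveSphere N'}
    (hb : 0 < N' (M *ᵥ k) → b.1 = (N' (M *ᵥ k))⁻¹ • (M *ᵥ k))
    (B : Set (PositiveSphere N')) :
    μ {x | ∃ y ∈ coneOver N' B, M.map ENNReal.ofReal *ᵥ x.1 = y.1}
      = ENNReal.ofReal (N' (M *ᵥ k) ^ α * (N k ^ α)⁻¹) * B.indicator 1 b := by
  set w := M *ᵥ k with hw
  have hw0 : ∀ i, 0 ≤ w i := Matrix.mulVec_apply_nonneg hM fun j => (hk j).le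
  have himage : ∀ (x : PuncturedOrthant d) (s : ℝ), 0 < s →
      (∀ j, x.1 j = ENNReal.ofReal (s * k j)) →
      M.map ENNReal.ofReal *ᵥ x.1 = fun i => ENNReal.ofReal (s * w i) := by
    intro x s hs hx
    ext i
    simp only [Matrix.mulVec, dotProduct, Matrix.map_apply, hx, hw]
    rw [Finset.mul_sum, ENNReal.ofReal_sum_of_nonneg fun j _ =>
      mul_nonneg hs.le (mul_nonneg (hM i j) (hk j).le)]
    refine Finset.sum_congr rfl fun j _ => ?_
    rw [← ENNReal.ofReal_mul (hM i j)]
    congr 1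
    ring
  -- On the line, membership in the preimage is a condition on the parameter `s` alone.
  have hmem : ∀ (x : PuncturedOrthant d) (s : ℝ), 0 < s →
      (∀ j, x.1 j = ENNReal.ofReal (s * k j)) →
      ((∃ y ∈ coneOver N' B, M.map ENNReal.ofReal *ᵥ x.1 = y.1) ↔ 1 < s * N' w ∧ b ∈ B) := by
    intro x s hs hx
    rw [himage x s hs hx]
    have hreal : (fun i => (ENNReal.ofReal (s * w i)).toReal) = s • w := by
      ext i
      rw [ENNReal.toReal_ofReal (mul_nonneg hs.le (hw0 i))]
      rfl
    have hnorm : N' (s • w) = s * N' w := by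
      rw [map_smul_eq_mul, Real.norm_of_nonneg hs.le]
    have hdir : 1 < s * N' w → (s * N' w)⁻¹ • s • w = b.1 := by
      intro h
      rw [hb (pos_of_mul_pos_right (one_pos.trans h) hs.le), smul_smul, mul_inv, mul_comm s⁻¹,
        mul_assoc, inv_mul_cancel₀ hs.ne', mul_one]
    constructor
    · rintro ⟨y, ⟨-, hy1, b', hb', hy2⟩, hy⟩
      rw [← hy, hreal, hnorm] at hy1 hy2
      rw [hdir hy1] at hy2
      exact ⟨hy1, Subtype.ext hy2 ▸ hb'⟩
    · rintro ⟨h, hbB⟩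
      refine ⟨⟨fun i => ENNReal.ofReal (s * w i), fun h0 => ?_⟩, ⟨fun i => by simp, ?_, b, hbB, ?_⟩,
        rfl⟩
      · have h0 : (fun i => ENNReal.ofReal (s * w i)) = 0 := h0
        have : s • w = 0 := by
          rw [← hreal]
          ext i
          simp [congrFun h0 i]
        rw [← hnorm, this, map_zero] at h
        exact absurd h (by norm_num)
      · simpa only [hreal, hnorm] using h
      · simpa only [hreal, hnorm] using hdir h
  by_cases hcase : 0 < N' w ∧ b ∈ B
  · obtain ⟨hpos, hbB⟩ := hcase
    rw [Set.indicator_of_mem hbB, Pi.one_apply, mul_one]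
    have hray := hμ.apply_ray hN hk hα hV hline o (inv_pos.2 hpos)
    rw [Real.inv_rpow hpos.le, Real.rpow_neg hpos.le, inv_inv] at hray
    rw [← hray]
    refine measure_congr ?_
    filter_upwards [compl_mem_ae_iff.2 hline] with x hx
    obtain ⟨s, hs, hx⟩ := not_not.1 hx
    refine propext ((hmem x s hs hx).trans ⟨fun h => ⟨s, ?_, hx⟩, fun ⟨s', hs', hx'⟩ => ?_⟩)
    · rw [inv_lt_iff_one_lt_mul₀ hpos]
      exact h.1
    · rw [← hmem x s hs hx, hmem x s' ((inv_pos.2 hpos).trans hs') hx',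
        ← inv_lt_iff_one_lt_mul₀ hpos]
      exact ⟨hs', hbB⟩
  · have hzero : ENNReal.ofReal (N' w ^ α * (N k ^ α)⁻¹) * B.indicator 1 b = 0 := by
      by_cases hbB : b ∈ B
      · have : N' w = 0 :=
          le_antisymm (not_lt.1 fun h => hcase ⟨h, hbB⟩) (apply_nonneg N' w)
        simp [this, Real.zero_rpow hα.ne']
      · simp [hbB]
    rw [hzero]
    refine measure_mono_null (fun x hx => ?_) hline
    rintro ⟨s, hs, hx'⟩
    obtain ⟨h1, h2⟩ := (hmem x s hs hx').1 hx
    exact hcase ⟨pos_of_mul_pos_right (one_pos.trans h1) hs.le, h2⟩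

/-! ### The spectral measure of the exposures -/

theorem weightMatrix_nonneg {q d : ℕ} (g : Fin q → Fin d → Bool) (i : Fin q) (j : Fin d) :
    0 ≤ weightMatrix g i j := by
  rw [weightMatrix, Matrix.of_apply]
  split_ifs <;> positivity

theorem weightMatrix_pos {q d : ℕ} {g : Fin q → Fin d → Bool} {i : Fin q} {j : Fin d}
    (h : g i j = true) : 0 < weightMatrix g i j := by
  have : 0 < objectDegree g j :=
    Finset.card_pos.2 ⟨i, Finset.mem_filter.2 ⟨Finset.mem_univ i, h⟩⟩
  rw [weightMatrix, Matrix.of_apply, if_pos h]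
  positivity

theorem hasPowerTail_of_tendsto_div {Ω : Type*} [MeasurableSpace Ω] {P : Measure Ω} {α K : ℝ}
    (hK : 0 < K) {X : Ω → ℝ}
    (h : Tendsto (fun t : ℝ => P.real {ω | t < X ω} / (K * t ^ (-α))) atTop (𝓝 1)) :
    HasPowerTail P α X K := by
  have h' := h.const_mul K
  rw [mul_one] at h'
  refine h'.congr' ?_
  filter_upwards [eventually_gt_atTop 0] with t ht
  have : t ^ α ≠ 0 := (Real.rpow_pos_of_pos ht _).ne'
  rw [Real.rpow_neg ht.le]
  field_simp

/-- The explicit spectral measure of `M_G V`: a mixture of point masses at the directions of the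
vectors `M_g k`. -/
theorem IsIntensityMeasure.isSpectralMeasure_mixture {Ω : Type*} [MeasurableSpace Ω]
    {P : Measure Ω} [IsProbabilityMeasure P] {Γ : Type*} [Fintype Γ] [MeasurableSpace Γ]
    [MeasurableSingletonClass Γ] {G : Ω → Γ} {q d : ℕ}
    {N : Seminorm ℝ (Fin d → ℝ)} {V : Ω → Fin d → ℝ} {μ : Measure (PuncturedOrthant d)}
    {α : ℝ} {k : Fin d → ℝ}
    (hμ : IsIntensityMeasure P V (outsideUnitBall N) μ) (hN : IsUnitNorm N) (hk : ∀ j, 0 < k j)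
    (hα : 0 < α) (hV : ∀ j, HasPowerTail P α (fun ω => V ω j) (k j ^ α))
    (hline : μ {x | ∃ s : ℝ, 0 < s ∧ ∀ j, x.1 j = ENNReal.ofReal (s * k j)}ᶜ = 0)
    (o : Fin d) {N' : Seminorm ℝ (Fin q → ℝ)} (hN' : IsUnitNorm N')
    {M : Γ → Matrix (Fin q) (Fin d) ℝ} (hM : ∀ g i j, 0 ≤ M g i j)
    (hG : Measurable G) (hindep : IndepFun V G P) {C : ℝ} (hC : 0 < C)
    (hCsum : ∑ g, P.real {ω | G ω = g} * N' (M g *ᵥ k) ^ α = C)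
    {θ : Γ → PositiveSphere N'}
    (hθ : ∀ g, 0 < N' (M g *ᵥ k) → (θ g).1 = (N' (M g *ᵥ k))⁻¹ • (M g *ᵥ k)) :
    IsSpectralMeasure P N' (fun ω => M (G ω) *ᵥ V ω) α
      (∑ g, ENNReal.ofReal (P.real {ω | G ω = g} * N' (M g *ᵥ k) ^ α / C) •
        Measure.dirac (θ g)) := by
  have hwt : ∀ g, 0 ≤ P.real {ω | G ω = g} * N' (M g *ᵥ k) ^ α / C := fun g =>
    div_nonneg (mul_nonneg measureReal_nonneg (Real.rpow_nonneg (apply_nonneg _ _) _)) hC.le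
  have hFm : Measurable fun ω => M (G ω) *ᵥ V ω := by
    refine measurable_pi_lambda _ fun i => ?_
    have : (fun ω => (M (G ω) *ᵥ V ω) i) = fun ω => ∑ j, M (G ω) i j * V ω j := rfl
    rw [this]
    exact Finset.measurable_fun_sum _ fun j _ =>
      ((measurable_of_finite fun g => M g i j).comp hG).mul
        ((measurable_pi_apply j).comp hμ.measurable)
  refine ⟨hFm, ?_, hα, ⟨?_⟩, fun u hu f => ?_⟩
  · filter_upwards [hμ.nonneg] with ω hω i
    exact Matrix.mulVec_apply_nonneg (hM (G ω)) hω i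
  · rw [Measure.finsetSum_apply]
    simp only [Measure.smul_apply, measure_univ, smul_eq_mul, mul_one]
    rw [← ENNReal.ofReal_sum_of_nonneg fun g _ => hwt g, ← Finset.sum_div, hCsum, div_self hC.ne',
      ENNReal.ofReal_one]
  · have hfm : Measurable f := f.continuous.measurable
    obtain ⟨D, hD⟩ := f.hasCompactSupport.exists_bound_of_continuous f.continuous
    have hD' : ∀ b, |f b| ≤ max D 0 := fun b => (hD b).trans (le_max_left _ _)
    -- Numerator and denominator of the normalized angular law, both multiplied by `t ^ α`
    have hnum := hμ.tendsto_setIntegral_mixture hN hk hα hV hline o hN' hM hG hindep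
      (φ := directional f) (C := max D 0) (c := fun g => f (θ g))
      ((measurable_extend_positiveSphere hN' hfm).comp
        hN'.measurable_direction)
      (abs_directional_le (le_max_right _ _) hD')
      (fun g hg δ hδ => directional_near hN' f.continuous (hθ g hg) hδ)
    have hden := hμ.tendsto_setIntegral_mixture hN hk hα hV hline o hN' hM hG hindep
      (φ := fun _ => 1) (C := 1) (c := fun _ => 1) measurable_const (fun _ => by simp)
      (fun g _ δ hδ => ⟨1, one_pos, fun x _ _ _ => by simpa using hδ.le⟩)
    simp only [mul_one] at hden
    rw [hCsum] at hden
    have hlim := ((hnum.comp (tendsto_id.atTop_mul_const hu)).const_mul (u ^ (-α))).mul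
      (hden.inv₀ hC.ne')
    have hval : ∫ b, f b ∂(ENNReal.ofReal (u ^ (-α)) •
        ∑ g, ENNReal.ofReal (P.real {ω | G ω = g} * N' (M g *ᵥ k) ^ α / C) •
          Measure.dirac (θ g))
        = u ^ (-α) * (∑ g, P.real {ω | G ω = g} * (N' (M g *ᵥ k) ^ α * f (θ g))) * C⁻¹ := by
      have hint : ∀ g, Integrable f
          (ENNReal.ofReal (P.real {ω | G ω = g} * N' (M g *ᵥ k) ^ α / C) •
            Measure.dirac (θ g)) := fun g =>
        (Integrable.of_bound hfm.aestronglyMeasurable D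
          (ae_of_all _ hD)).smul_measure ENNReal.ofReal_ne_top
      rw [integral_smul_measure, ENNReal.toReal_ofReal (Real.rpow_nonneg hu.le _), smul_eq_mul,
        integral_finsetSum_measure fun g _ => hint g, mul_assoc, Finset.sum_mul]
      congr 1
      refine Finset.sum_congr rfl fun g _ => ?_
      rw [integral_smul_measure, ENNReal.toReal_ofReal (hwt g),
        integral_dirac' _ _ hfm.stronglyMeasurable, smul_eq_mul]
      ring
    rw [hval]
    refine hlim.congr' ?_
    filter_upwards [eventually_gt_atTop 0] with t ht
    have htα : t ^ α ≠ 0 := (Real.rpow_pos_of_pos ht _).ne'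
    rw [integral_smul_measure, ENNReal.toReal_inv, smul_eq_mul,
      integral_angularLaw hN' hFm hfm]
    simp only [Function.comp, id, integral_const, smul_eq_mul, mul_one,
      measureReal_restrict_apply_univ]
    simp only [Measure.real]
    rw [Real.mul_rpow ht.le hu.le, mul_inv, Real.rpow_neg hu.le]
    have huα : u ^ α ≠ 0 := (Real.rpow_pos_of_pos hu _).ne'
    field_simp

theorem matrixSupport_eq {Ω : Type*} [MeasurableSpace Ω] {P : Measure Ω} {Γ : Type*} [Fintype Γ]
    {G : Ω → Γ} {q d : ℕ} (M : Γ → Matrix (Fin q) (Fin d) ℝ) :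
    matrixSupport P (fun ω => M (G ω)) = {A | ∃ g, P {ω | G ω = g} ≠ 0 ∧ M g = A} := by
  ext A
  simp only [matrixSupport, Set.mem_ofPred_eq, pos_iff_ne_zero]
  constructor
  · contrapose!
    intro h
    have hsub : {ω | M (G ω) = A} ⊆ ⋃ g, {ω | G ω = g ∧ M g = A} := fun ω hω =>
      Set.mem_iUnion.2 ⟨G ω, rfl, hω⟩
    refine measure_mono_null hsub (measure_iUnion_null fun g => ?_)
    by_cases hg : M g = A
    · simpa [hg] using not_imp_comm.1 (h g) (not_not.2 hg)
    · simp [hg]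
  · rintro ⟨g, hg, rfl⟩ h0
    exact hg (measure_mono_null (fun ω (hω : G ω = g) => congrArg M hω) h0)

theorem corollary3p4 {Ω : Type*} [MeasurableSpace Ω] (P : Measure Ω) [IsProbabilityMeasure P]
    {q d : ℕ}
    -- the norms on `ℝ^d` and `ℝ^q`
    (Nd : Seminorm ℝ (Fin d → ℝ)) (hNd : IsUnitNorm Nd)
    (Nq : Seminorm ℝ (Fin q → ℝ)) (hNq : IsUnitNorm Nq)
    -- the random network; links are not all almost surely absent
    (p : Fin q → Fin d → ℝ) (G : Ω → Fin q → Fin d → Bool) (hG : IsRandomBipartiteGraph P G p)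
    (hp : ∃ i j, 0 < p i j)
    -- the claims: Pareto tails, intensity measure, independence of the network
    (α : ℝ) (hα : 0 < α) (K : Fin d → ℝ) (hK : ∀ j, 0 < K j)
    (V : Ω → Fin d → ℝ)
    (htail : ∀ j, Tendsto (fun t : ℝ => P.real {ω | t < V ω j} / (K j * t ^ (-α))) atTop (𝓝 1))
    (μ : Measure (PuncturedOrthant d)) (hμ : IsIntensityMeasure P V (outsideUnitBall Nd) μ)
    (hindep : IndepFun V G P)
    (hdep : IsFullyDependent α K μ)
    -- the weighted adjacency matrix and the exposures
    (A : Ω → Matrix (Fin q) (Fin d) ℝ) (hA : ∀ ω, A ω = weightMatrix (G ω))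
    (F : Ω → Fin q → ℝ) (hF : ∀ ω, F ω = A ω *ᵥ V ω) :
    (∃ ρ : Measure (PositiveSphere Nq), IsSpectralMeasure P Nq F α ρ) ∧
    ∀ ρ : Measure (PositiveSphere Nq), IsSpectralMeasure P Nq F α ρ →
      (Subtype.val '' ρ.support =
        {b | ∃ M ∈ matrixSupport P A, M *ᵥ 1 ≠ 0 ∧
          b = (Nq (M *ᵥ (tailScale α K *ᵥ 1)))⁻¹ • (M *ᵥ (tailScale α K *ᵥ 1))}) ∧
      ∀ B : Set (PositiveSphere Nq), MeasurableSet B →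
        ρ B = ENNReal.ofReal (Nd (tailScale α K *ᵥ 1) ^ α * (systemicConstant P Nq A α K)⁻¹) *
          expectedPushforward P A μ (coneOver Nq B) := by
  obtain ⟨i₀, o, hp⟩ := hp
  obtain rfl : A = fun ω => weightMatrix (G ω) := funext hA
  obtain rfl : F = fun ω => weightMatrix (G ω) *ᵥ V ω := funext hF
  have hGm := hG.measurable
  set k : Fin d → ℝ := tailScale α K *ᵥ 1 with hkdef
  have hkj : ∀ j, k j = K j ^ (1 / α) := fun j => by
    simp [hkdef, tailScale, Matrix.mulVec_diagonal]
  have hk : ∀ j, 0 < k j := fun j => hkj j ▸ Real.rpow_pos_of_pos (hK j) _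
  have hNk : 0 < Nd k ^ α :=
    Real.rpow_pos_of_pos (hNd.pos fun h => (hk o).ne' (congrFun h o)) _
  have hV : ∀ j, HasPowerTail P α (fun ω => V ω j) (k j ^ α) := fun j => by
    rw [hkj, ← Real.rpow_mul (hK j).le, one_div_mul_cancel hα.ne', Real.rpow_one]
    exact hasPowerTail_of_tendsto_div (hK j) (htail j)
  have hline : μ {x | ∃ s : ℝ, 0 < s ∧ ∀ j, x.1 j = ENNReal.ofReal (s * k j)}ᶜ = 0 := hdep
  let w : (Fin q → Fin d → Bool) → Fin q → ℝ := fun g => weightMatrix g *ᵥ k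
  set C : ℝ := systemicConstant P Nq (fun ω => weightMatrix (G ω)) α K with hCdef
  have hCsum : ∑ g, P.real {ω | G ω = g} * Nq (w g) ^ α = C :=
    (integral_comp_eq_sum hGm fun g => Nq (w g) ^ α).symm
  -- Some graph with a link has positive probability
  obtain ⟨g₀, hg₀, hg₀w⟩ : ∃ g, P {ω | G ω = g} ≠ 0 ∧ w g ≠ 0 := by
    by_contra! hcon
    refine hp.ne' ((hG.prob i₀ o).symm.trans ?_)
    rw [measureReal_eq_zero_iff]
    have hsub : {ω | G ω i₀ o = true} ⊆ ⋃ g, {ω | G ω = g ∧ g i₀ o = true} := fun ω hω =>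
      Set.mem_iUnion.2 ⟨G ω, rfl, hω⟩
    refine measure_mono_null hsub (measure_iUnion_null fun g => ?_)
    by_cases hg : g i₀ o = true
    · refine measure_mono_null (fun ω hω => hω.1) (not_imp_comm.1 (hcon g) fun h0 => ?_)
      rw [Matrix.mulVec_eq_zero_iff_of_pos (weightMatrix_nonneg g) hk] at h0
      exact (weightMatrix_pos hg).ne' (by simp [h0])
    · simp [hg]
  have hCpos : 0 < C := by
    rw [← hCsum]
    refine Finset.sum_pos' (fun g _ => mul_nonneg measureReal_nonneg
      (Real.rpow_nonneg (apply_nonneg _ _) _)) ⟨g₀, Finset.mem_univ _, ?_⟩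
    exact mul_pos (ENNReal.toReal_pos hg₀ (measure_ne_top _ _))
      (Real.rpow_pos_of_pos (hNq.pos hg₀w) _)
  have hw0 : ∀ g i, 0 ≤ w g i := fun g =>
    Matrix.mulVec_apply_nonneg (weightMatrix_nonneg g) fun j => (hk j).le
  obtain ⟨θ, hθ⟩ : ∃ θ : (Fin q → Fin d → Bool) → PositiveSphere Nq,
      ∀ g, 0 < Nq (w g) → (θ g).1 = (Nq (w g))⁻¹ • w g := by
    have : ∀ g, ∃ b : PositiveSphere Nq, 0 < Nq (w g) → b.1 = (Nq (w g))⁻¹ • w g := by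
      intro g
      by_cases hg : 0 < Nq (w g)
      · exact ⟨⟨_, direction_mem_positiveSphere (hw0 g) hg⟩, fun _ => rfl⟩
      · exact ⟨⟨_, direction_mem_positiveSphere (hw0 g₀) (hNq.pos hg₀w)⟩, fun h => absurd h hg⟩
    choose θ hθ using this
    exact ⟨θ, hθ⟩
  have hspec := hμ.isSpectralMeasure_mixture hNd hk hα hV hline o hNq
    (M := weightMatrix) weightMatrix_nonneg hGm hindep hCpos hCsum hθ
  refine ⟨⟨_, hspec⟩, fun ρ hρ => ?_⟩
  obtain rfl := hρ.unique hNq hspec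
  constructor
  · rw [support_sum_dirac, matrixSupport_eq]
    have hiff : ∀ g, ENNReal.ofReal (P.real {ω | G ω = g} * Nq (w g) ^ α / C) ≠ 0 ↔
        P {ω | G ω = g} ≠ 0 ∧ w g ≠ 0 := by
      intro g
      rw [← pos_iff_ne_zero, ENNReal.ofReal_pos, div_pos_iff_of_pos_right hCpos]
      constructor
      · intro h
        refine ⟨fun h0 => ?_, fun h0 => ?_⟩
        · simp [Measure.real, h0] at h
        · simp [h0, Real.zero_rpow hα.ne'] at h
      · rintro ⟨h1, h2⟩
        exact mul_pos (ENNReal.toReal_pos h1 (measure_ne_top _ _))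
          (Real.rpow_pos_of_pos (hNq.pos h2) _)
    have hone : ∀ g, weightMatrix g *ᵥ (1 : Fin d → ℝ) ≠ 0 ↔ w g ≠ 0 := fun g =>
      ((Matrix.mulVec_eq_zero_iff_of_pos (weightMatrix_nonneg g) fun _ => one_pos).trans
        (Matrix.mulVec_eq_zero_iff_of_pos (weightMatrix_nonneg g) hk).symm).not
    ext b
    constructor
    · rintro ⟨y, ⟨g, hg, rfl⟩, rfl⟩
      obtain ⟨h1, h2⟩ := (hiff g).1 hg
      exact ⟨_, ⟨g, h1, rfl⟩, (hone g).2 h2, hθ g (hNq.pos h2)⟩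
    · rintro ⟨_, ⟨g, h1, rfl⟩, h2, rfl⟩
      have h2' := (hone g).1 h2
      exact ⟨θ g, ⟨g, (hiff g).2 ⟨h1, h2'⟩, rfl⟩, hθ g (hNq.pos h2')⟩
  · intro B hB
    have hpush : expectedPushforward P (fun ω => weightMatrix (G ω)) μ (coneOver Nq B)
        = ∑ g, P {ω | G ω = g} *
          (ENNReal.ofReal (Nq (w g) ^ α * (Nd k ^ α)⁻¹) * B.indicator 1 (θ g)) := by
      rw [expectedPushforward, lintegral_comp_eq_sum hGm fun g =>
        μ {x | ∃ y ∈ coneOver Nq B, (weightMatrix g).map ENNReal.ofReal *ᵥ x.1 = y.1}]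
      exact Finset.sum_congr rfl fun g _ => by
        rw [hμ.apply_preimage_coneOver hNd hk hα hV hline o (weightMatrix_nonneg g) (hθ g)]
    rw [hpush, Measure.finsetSum_apply, Finset.mul_sum]
    refine Finset.sum_congr rfl fun g _ => ?_
    have hNw : 0 ≤ Nq (w g) ^ α := Real.rpow_nonneg (apply_nonneg _ _) _
    rw [Measure.smul_apply, Measure.dirac_apply' _ hB, smul_eq_mul, ← mul_assoc, ← mul_assoc,
      ← ofReal_measureReal (μ := P) (s := {ω | G ω = g}),
      ← ENNReal.ofReal_mul (mul_nonneg hNk.le (inv_nonneg.2 hCpos.le)),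
      ← ENNReal.ofReal_mul (mul_nonneg (mul_nonneg hNk.le (inv_nonneg.2 hCpos.le))
        measureReal_nonneg)]
    congr 2
    field_simp
    rfl
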